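/- Let $d\ge 0$, $m\ge 1$, and let $P(\partial_t,D_x)=\partial_t^m+\sum_{k=1}^m a_k(D_x)\,\partial_t^{m-k}$, $t\in\mathbb R$, $x\in\mathbb R^d$, where $a_1,\dots,a_m$ are polynomials on $\mathbb{R}^d$ with complex coefficients and $D_{x_j}=\frac{1}{2\pi i}\partial_{x_j}$; its symbol is $P(i\tau,\zeta)=(i\tau)^m+\sum_{k=1}^m a_k(\zeta)(i\tau)^{m-k}$, a polynomial in $(\tau,\zeta)\in\mathbb C\times\mathbb C^d$. Assume that $P$ is hyperbolic with respect to $t$ (not necessarily strictly), that is, the homogeneous part of highest order of the symbol does not vanish at $(\tau,\zeta)=(1,0,\dots,0)$, and there is $C>0$ such that $$(\tau,\xi)\in\mathbb C\times\mathbb R^d,\quad P(i\tau,\xi)=0\ \Longrightarrow\ \operatorname{Im}\tau\ge -C .$$ Then: (1) There is a constant $C>0$ such that $$(\tau,\zeta)\in\mathbb C\times\mathbb C^d,\quad P(i\tau,\zeta)=0\ \Longrightarrow\ \operatorname{Im}\tau\ge -C\,(1+|\operatorname{Im}\zeta|).$$ (2) There is a unique function $\sigma(t,\xi)$ on $\mathbb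 R\times\mathbb R^d$ such that, for every $\xi$, $\sigma(\cdot,\xi)$ vanishes for $t<0$, is continuous on $[0,+\infty)$ and satisfies $\big(\partial_t^m+\sum_{k=1}^m a_k(\xi)\partial_t^{m-k}\big)\sigma(t,\xi)=\delta(t)$ in the sense of distributions on $\mathbb R$. Let $\sigma(t,D_x)f=\mathcal F^{-1}\big(\sigma(t,\cdot)\,\mathcal F f\big)$, with $\mathcal Ff(\xi)=\int f(x)e^{-2\pi i x\cdot\xi}\,dx$, be the corresponding propagator. For $z=(x,\xi)\in\mathbb R^{2d}$ put $\pi(z)f(y)=e^{2\pi i\xi\cdot y}f(y-x)$, and let $\langle f,h\rangle=\int f\,\overline h\,dy$. Let $g\in S^{1/2}_{1/2}(\mathbb R^d)$, that is, $g$ is a Schwartz function and there are $A,B,K>0$ with $|x^\alpha\partial^\beta g(x)|\le K A^{|\alpha|}B^{|\beta|}(\alpha!)^{1/2}(\beta!)^{1/2}$ for all $x\in\mathbb{R}^d$ and all multi-indices $\alpha,\beta\in\mathbb{N}^d$. Then for every $T\geq 0$ there are constants $C>0$ and $\varepsilon>0$ such that, for all $t\in[0,T]$ and all $z,w\in\mathbb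 R^{2d}$, the integrals defining $\sigma(t,D_x)\pi(z)g$ and the pairing below converge absolutely, and $$|\langle\sigma(t,D_x)\pi(z)g,\pi(w)g\rangle|\le C\exp\big(-\varepsilon|w-z|^2\big).$$ -/

import Mathlib

open scoped FourierTransform SchwartzMap ContDiff

noncomputable section

/-- The Euclidean space `ℝ^d`. -/
abbrev Rd (d : ℕ) : Type := EuclideanSpace ℝ (Fin d)

/-- The time-frequency plane `ℝ^d × ℝ^d`, with its Euclidean norm. -/
abbrev TFPlane (d : ℕ) : Type := WithLp 2 (Rd d × Rd d)

/-! ### Operators `P(∂_t, D_x) = ∂_t^m + ∑_{k=1}^m a_k(D_x) ∂_t^{m-k}` -/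

/-- The symbol `P(iτ, ζ) = (iτ)^m + ∑_{k=1}^m a_k(ζ) (iτ)^{m-k}`, as a polynomial in the `d + 1`
variables `(τ, ζ_1, …, ζ_d)`, the variable of index `0` being `τ`. -/
def fullSymbol {d : ℕ} (m : ℕ) (a : ℕ → MvPolynomial (Fin d) ℂ) : MvPolynomial (Fin (d + 1)) ℂ :=
  (MvPolynomial.C Complex.I * MvPolynomial.X 0) ^ m +
    ∑ k ∈ Finset.Icc 1 m, MvPolynomial.rename Fin.succ (a k) *
      (MvPolynomial.C Complex.I * MvPolynomial.X 0) ^ (m - k)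

/-- The value `P(iτ, ζ)` at `τ ∈ ℂ`, `ζ ∈ ℂ^d`. -/
def symbolValue {d : ℕ} (m : ℕ) (a : ℕ → MvPolynomial (Fin d) ℂ) (τ : ℂ) (ζ : Fin d → ℂ) : ℂ :=
  MvPolynomial.eval (Fin.cons τ ζ : Fin (d + 1) → ℂ) (fullSymbol m a)

/-- The forward Hadamard-Petrowsky condition. -/
def HadamardPetrowsky {d : ℕ} (m : ℕ) (a : ℕ → MvPolynomial (Fin d) ℂ) : Prop :=
  ∃ C : ℝ, 0 < C ∧ ∀ (τ : ℂ) (ξ : Rd d),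
    symbolValue m a τ (fun j => ((ξ j : ℝ) : ℂ)) = 0 → -C ≤ τ.im

/-- The refined Hadamard-Petrowsky condition with exponent `ν`. -/
def RefinedHadamardPetrowsky {d : ℕ} (m : ℕ) (a : ℕ → MvPolynomial (Fin d) ℂ) (ν : ℝ) : Prop :=
  ∃ C : ℝ, 0 < C ∧ ∀ (τ : ℂ) (ζ : Fin d → ℂ), symbolValue m a τ ζ = 0 →
    -C * (1 + ‖(WithLp.toLp 2 (fun j => (ζ j).im) : Rd d)‖) ^ ν ≤ τ.im

/-- The homogeneous part of highest order of the symbol. -/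
def principalPart {d : ℕ} (m : ℕ) (a : ℕ → MvPolynomial (Fin d) ℂ) :
    MvPolynomial (Fin (d + 1)) ℂ :=
  MvPolynomial.homogeneousComponent (fullSymbol m a).totalDegree (fullSymbol m a)

/-- Hyperbolicity with respect to `t`: the principal part does not vanish at `(1, 0, …, 0)`, and
the forward Hadamard-Petrowsky condition holds. -/
def IsHyperbolic {d : ℕ} (m : ℕ) (a : ℕ → MvPolynomial (Fin d) ℂ) : Prop :=
  MvPolynomial.eval (Fin.cons 1 0 : Fin (d + 1) → ℂ) (principalPart m a) ≠ 0 ∧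
    HadamardPetrowsky m a

/-! ### The fundamental solution on the Fourier side and the propagator -/

/-- `(∂_t^m + ∑_{k=1}^m a_k(ξ) ∂_t^{m-k}) σ(t, ξ) = δ(t)` with `σ` supported in `[0, ∞) × ℝ^d`:
for every `ξ` the equation holds in the sense of distributions on `ℝ`, and `σ(·, ξ)` is the
representative which is `0` for `t < 0` and continuous on `[0, ∞)` (so that it has a definite value
at every `t ≥ 0`). -/
structure IsFundamentalSymbol {d : ℕ} (m : ℕ) (a : ℕ → MvPolynomial (Fin d) ℂ)
    (σ : ℝ → Rd d → ℂ) : Prop where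
  eq_zero_of_neg : ∀ t < 0, ∀ ξ, σ t ξ = 0
  continuousOn : ∀ ξ, ContinuousOn (fun t => σ t ξ) (Set.Ici 0)
  weak_eq : ∀ (ξ : Rd d) (φ : ℝ → ℂ), ContDiff ℝ ∞ φ → HasCompactSupport φ →
    ∫ t, σ t ξ * ((-1) ^ m * iteratedDeriv m φ t +
      ∑ k ∈ Finset.Icc 1 m, MvPolynomial.eval (fun j => ((ξ j : ℝ) : ℂ)) (a k) *
        ((-1) ^ (m - k) * iteratedDeriv (m - k) φ t)) = φ 0

/-- The Fourier multiplier `s(D_x) f = 𝓕⁻¹ (s · 𝓕 f)`. -/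
def fourierMultiplier {d : ℕ} (s : Rd d → ℂ) (f : Rd d → ℂ) : Rd d → ℂ :=
  𝓕⁻ (fun ξ => s ξ * 𝓕 f ξ)

/-! ### Time-frequency shifts and the Gabor matrix -/

/-- The time-frequency shift `π(z) f = M_ξ T_x f`, for `z = (x, ξ)`. -/
def tfShift {d : ℕ} (z : TFPlane d) (f : Rd d → ℂ) : Rd d → ℂ :=
  fun y => Complex.exp (2 * Real.pi * Complex.I * ((inner ℝ z.snd y : ℝ) : ℂ)) * f (y - z.fst)

/-- The entry `⟨A π(z) g, π(w) g⟩` of the Gabor matrix of an operator `A`, with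
`⟨f, h⟩ = ∫ f(y) conj (h(y)) dy`. -/
def gaborMatrix {d : ℕ} (A : (Rd d → ℂ) → Rd d → ℂ) (g : Rd d → ℂ) (z w : TFPlane d) : ℂ :=
  ∫ y, A (tfShift z g) y * (starRingEnd ℂ) (tfShift w g y)

/-! ### Gelfand-Shilov spaces -/

/-- The partial derivative `∂^β f` for a multi-index `β`. -/
def multiDeriv {d : ℕ} (β : Fin d → ℕ) (f : 𝓢(Rd d, ℂ)) : 𝓢(Rd d, ℂ) :=
  (List.finRange d).foldr
    (fun j h => (fun u : 𝓢(Rd d, ℂ) =>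
      LineDeriv.lineDerivOp (EuclideanSpace.single j (1 : ℝ)) u)^[β j] h) f

/-- The factorial `α! = ∏ α_j!` of a multi-index. -/
def multiFactorial {d : ℕ} (α : Fin d → ℕ) : ℕ := ∏ j, (α j).factorial

/-- `f ∈ S^s_r(ℝ^d)`: there are `A, B > 0` and `K` with
`|x^α ∂^β f(x)| ≤ K A^|α| B^|β| (α!)^r (β!)^s` for all `x`, `α`, `β`. -/
def IsGelfandShilov {d : ℕ} (s r : ℝ) (f : 𝓢(Rd d, ℂ)) : Prop :=
  ∃ A B K : ℝ, 0 < A ∧ 0 < B ∧ ∀ (α β : Fin d → ℕ) (x : Rd d),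
    ‖((∏ j, x j ^ α j : ℝ) : ℂ) * multiDeriv β f x‖ ≤
      K * A ^ (∑ j, α j) * B ^ (∑ j, β j) *
        (multiFactorial α : ℝ) ^ r * (multiFactorial β : ℝ) ^ s

end

/-! ### Restriction of a polynomial to a complex line -/

/-- The restriction `z ↦ F (p + z q)` of a polynomial to a complex line. -/
noncomputable def lineRestriction {ι : Type*} (p q : ι → ℂ) (F : MvPolynomial ι ℂ) :
    Polynomial ℂ :=
  MvPolynomial.aeval (fun i => Polynomial.C (p i) + Polynomial.C (q i) * Polynomial.X) F

lemma eval_lineRestriction {ι : Type*} (p q : ι → ℂ) (F : MvPolynomial ι ℂ) (z : ℂ) :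
    (lineRestriction p q F).eval z = MvPolynomial.eval (fun i => p i + z * q i) F := by
  unfold lineRestriction
  induction F using MvPolynomial.induction_on with
  | C c => simp
  | add F G hF hG => simp [hF, hG]
  | mul_X F i hF => simp [hF, mul_comm z]

lemma continuous_coeff_lineRestriction {ι : Type*} (p : ι → ℂ) (F : MvPolynomial ι ℂ) (k : ℕ) :
    Continuous fun q : ι → ℂ => (lineRestriction p q F).coeff k := by
  unfold lineRestriction
  induction F using MvPolynomial.induction_on generalizing k with
  | C c =>
    simp only [MvPolynomial.algHom_C]
    exact continuous_const
  | add F G hF hG =>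
    simp only [map_add, Polynomial.coeff_add]
    exact (hF k).add (hG k)
  | mul_X F i hF =>
    simp only [map_mul, MvPolynomial.aeval_X, mul_add, Polynomial.coeff_add, ← mul_assoc,
      Polynomial.coeff_mul_C]
    refine ((hF k).mul continuous_const).add ?_
    cases k with
    | zero => simpa using continuous_const
    | succ k =>
      simp only [Polynomial.coeff_mul_X, Polynomial.coeff_mul_C]
      exact (hF k).mul (continuous_apply i)

lemma natDegree_lineRestriction_le {ι : Type*} (p q : ι → ℂ) (F : MvPolynomial ι ℂ) :
    (lineRestriction p q F).natDegree ≤ F.totalDegree := by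
  have := MvPolynomial.aeval_natDegree_le F le_rfl
    (fun i => Polynomial.C (p i) + Polynomial.C (q i) * Polynomial.X) (n := 1) (fun i => by
      rw [add_comm]; exact Polynomial.natDegree_linear_le)
  simpa [lineRestriction] using this

lemma coeff_prod_pow_of_natDegree_le_one {ι : Type*} (s : Finset ι) (e : ι → ℕ)
    (f : ι → Polynomial ℂ) (hf : ∀ i, (f i).natDegree ≤ 1) :
    (∏ i ∈ s, f i ^ e i).coeff (∑ i ∈ s, e i) = ∏ i ∈ s, (f i).coeff 1 ^ e i := by
  classical
  have hp : ∀ i, (f i ^ e i).natDegree ≤ e i := fun i => by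
    simpa using Polynomial.natDegree_pow_le_of_le (e i) (hf i)
  induction s using Finset.induction_on with
  | empty => simp
  | insert i s hi ih =>
    rw [Finset.prod_insert hi, Finset.sum_insert hi, Finset.prod_insert hi,
      Polynomial.coeff_mul_add_eq_of_natDegree_le (hp i)
        ((Polynomial.natDegree_prod_le _ _).trans (Finset.sum_le_sum fun i _ => hp i)), ih]
    congr 1
    simpa using Polynomial.coeff_pow_of_natDegree_le (m := e i) (hf i)

lemma coeff_totalDegree_lineRestriction {ι : Type*} (p q : ι → ℂ) (F : MvPolynomial ι ℂ) :
    (lineRestriction p q F).coeff F.totalDegree =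
      MvPolynomial.eval q (MvPolynomial.homogeneousComponent F.totalDegree F) := by
  rw [MvPolynomial.homogeneousComponent_apply, map_sum, Finset.sum_filter]
  unfold lineRestriction
  rw [MvPolynomial.aeval_def, MvPolynomial.eval₂, Finsupp.sum, Polynomial.finsetSum_coeff]
  refine Finset.sum_congr rfl fun e he => ?_
  have hlin : ∀ i, (Polynomial.C (p i) + Polynomial.C (q i) * Polynomial.X).natDegree ≤ 1 :=
    fun i => by rw [add_comm]; exact Polynomial.natDegree_linear_le
  rw [Polynomial.algebraMap_apply, Polynomial.coeff_C_mul]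
  have hle : e.degree ≤ F.totalDegree := MvPolynomial.le_totalDegree he
  split_ifs with h
  · have := coeff_prod_pow_of_natDegree_le_one e.support e _ hlin
    have hdeg : F.totalDegree = ∑ i ∈ e.support, e i := h.symm
    rw [MvPolynomial.eval_monomial, hdeg, Finsupp.prod]
    simp only [Algebra.algebraMap_self, RingHom.id_apply]
    rw [this]
    simp only [Polynomial.coeff_add, Polynomial.coeff_C_succ, Polynomial.coeff_C_mul,
      Polynomial.coeff_X_one, mul_one, zero_add]
    rfl
  · rw [Polynomial.coeff_eq_zero_of_natDegree_lt, mul_zero]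
    refine lt_of_le_of_lt ?_ (lt_of_le_of_ne hle h)
    refine (Polynomial.natDegree_prod_le _ _).trans ?_
    exact Finset.sum_le_sum fun i _ => by
      simpa using Polynomial.natDegree_pow_le_of_le (e i) (hlin i)

lemma MvPolynomial.IsHomogeneous.eval_const_mul {ι : Type*} {G : MvPolynomial ι ℂ} {N : ℕ}
    (hG : G.IsHomogeneous N) (c : ℂ) (q : ι → ℂ) :
    MvPolynomial.eval (fun i => c * q i) G = c ^ N * MvPolynomial.eval q G := by
  rw [MvPolynomial.eval_eq, MvPolynomial.eval_eq, Finset.mul_sum]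
  refine Finset.sum_congr rfl fun e he => ?_
  have : ∑ i ∈ e.support, e i = N := by
    have h := hG (MvPolynomial.mem_support_iff.1 he)
    rwa [Pi.one_def, ← Finsupp.degree_eq_weight_one] at h
  simp_rw [mul_pow, Finset.prod_mul_distrib, Finset.prod_pow_eq_pow_sum]
  rw [this]
  ring

/-! ### Gårding's theorem on the zeros of a hyperbolic polynomial -/

lemma Polynomial.le_norm_eval_of_roots_re_pos {L : Polynomial ℂ} {z : ℂ} {N : ℕ}
    (hN : L.natDegree = N) (hroots : ∀ w, L.eval w = 0 → 0 < w.re) (hz : z.re < 0) :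
    ‖L.leadingCoeff‖ * (-z.re) ^ N ≤ ‖L.eval z‖ := by
  rw [(IsAlgClosed.splits L).eval_eq_prod_roots, norm_mul]
  refine mul_le_mul_of_nonneg_left ?_ (norm_nonneg _)
  by_cases hL : L = 0
  · exact absurd (hroots 0 (by simp [hL])) (by simp)
  have hcard : L.roots.card = N := by
    rw [← hN]; exact (IsAlgClosed.splits L).natDegree_eq_card_roots.symm
  have key : ∀ s : Multiset ℂ, (∀ w ∈ s, 0 < w.re) →
      (-z.re) ^ s.card ≤ ‖(s.map (z - ·)).prod‖ := by
    intro s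
    induction s using Multiset.induction_on with
    | empty => simp
    | cons w s ih =>
      intro h
      rw [Multiset.card_cons, pow_succ, Multiset.map_cons, Multiset.prod_cons, norm_mul, mul_comm]
      have h1 : -z.re ≤ ‖z - w‖ := by
        have := Complex.abs_re_le_norm (z - w)
        have := neg_abs_le (z - w).re
        have := h w (by simp)
        simp only [Complex.sub_re] at *
        linarith
      have h2 := ih fun w hw => h w (by simp [hw])
      have h3 : 0 ≤ -z.re := by linarith
      exact mul_le_mul h1 h2 (by positivity) (norm_nonneg _)
  rw [← hcard]
  exact key _ fun w hw => hroots w (by simpa using (Polynomial.mem_roots hL).1 hw)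

lemma roots_re_pos_of_continuous_family {N : ℕ} (L : unitInterval → Polynomial ℂ)
    (hcoeff : ∀ k, Continuous fun s => (L s).coeff k) (hdeg : ∀ s, (L s).natDegree ≤ N)
    (hlead : ∀ s, (L s).coeff N ≠ 0)
    (haxis : ∀ s z, z.re = 0 → (L s).eval z ≠ 0)
    (h0 : ∀ z, (L 0).eval z = 0 → 0 < z.re) :
    ∀ z, (L 1).eval z = 0 → 0 < z.re := by
  have hN : ∀ s, (L s).natDegree = N := fun s =>
    le_antisymm (hdeg s) (Polynomial.le_natDegree_of_ne_zero (hlead s))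
  have hne : ∀ s, L s ≠ 0 := fun s h => hlead s (by simp [h])
  have heval : Continuous fun x : unitInterval × ℂ => (L x.1).eval x.2 := by
    have : (fun x : unitInterval × ℂ => (L x.1).eval x.2) =
        fun x => ∑ k ∈ Finset.range (N + 1), (L x.1).coeff k * x.2 ^ k := by
      funext x
      rw [Polynomial.eval_eq_sum_range, hN]
    rw [this]
    exact continuous_finsetSum _ fun k _ =>
      ((hcoeff k).comp continuous_fst).mul (continuous_snd.pow k)
  obtain ⟨R, hR⟩ : ∃ R : ℝ, ∀ s z, (L s).eval z = 0 → ‖z‖ ≤ R := by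
    have hb : ∀ k, ∃ M : NNReal, ∀ s, ‖(L s).coeff k / (L s).coeff N‖₊ ≤ M := by
      intro k
      obtain ⟨M, hM⟩ := (isCompact_univ (X := unitInterval)).exists_bound_of_continuousOn
        (((hcoeff k).div (hcoeff N) hlead).continuousOn)
      refine ⟨M.toNNReal, fun s => ?_⟩
      rw [← NNReal.coe_le_coe, coe_nnnorm]
      exact (hM s trivial).trans (Real.le_coe_toNNReal M)
    choose M hM using hb
    refine ⟨(Finset.sum (Finset.range N) M : NNReal) + 1, fun s z hz => ?_⟩
    have h1 := Polynomial.IsRoot.norm_lt_cauchyBound (hne s) (a := z) hz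
    rw [← NNReal.coe_lt_coe, coe_nnnorm] at h1
    refine h1.le.trans ?_
    rw [← NNReal.coe_one, ← NNReal.coe_add, NNReal.coe_le_coe]
    unfold Polynomial.cauchyBound
    gcongr
    rw [hN, Polynomial.leadingCoeff, hN, div_le_iff₀ (by simpa using hlead s)]
    refine Finset.sup_le fun k hk => ?_
    have h2 := hM k s
    rw [nnnorm_div, div_le_iff₀ (by simpa using hlead s)] at h2
    refine h2.trans ?_
    gcongr
    exact Finset.single_le_sum (f := M) (fun _ _ => zero_le) hk
  set A : Set unitInterval := {s | ∀ z, (L s).eval z = 0 → 0 < z.re} with hA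
  have hopen : IsOpen A := by
    rw [← isClosed_compl_iff]
    have : Aᶜ = Prod.fst '' (({x : unitInterval × ℂ | (L x.1).eval x.2 = 0} ∩
        {x | x.2.re ≤ 0}) ∩ (Set.univ ×ˢ Metric.closedBall (0 : ℂ) R)) := by
      ext s
      simp only [hA, Set.mem_compl_iff, Set.mem_ofPred_eq, not_forall, not_lt, Set.mem_image,
        Set.mem_inter_iff, Set.mem_prod, Set.mem_univ, true_and, Metric.mem_closedBall,
        dist_zero_right, Prod.exists, exists_and_right, exists_eq_right]
      constructor
      · rintro ⟨z, hz, hz'⟩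
        exact ⟨z, ⟨hz, hz'⟩, hR s z hz⟩
      · rintro ⟨z, ⟨hz, hz'⟩, -⟩
        exact ⟨z, hz, hz'⟩
    rw [this]
    refine IsCompact.isClosed (IsCompact.image ?_ continuous_fst)
    refine IsCompact.inter_left (isCompact_univ.prod (isCompact_closedBall _ _)) ?_
    exact (isClosed_eq heval continuous_const).inter
      (isClosed_le (Complex.continuous_re.comp continuous_snd) continuous_const)
  have hclosed : IsClosed A := by
    refine isClosed_of_closure_subset fun s hs z hz => ?_
    have hz0 : z.re ≠ 0 := fun h => haxis s z h hz
    by_contra hneg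
    have hlt : z.re < 0 := lt_of_le_of_ne (not_lt.1 hneg) hz0
    have hcl : IsClosed {s | ‖(L s).coeff N‖ * (-z.re) ^ N ≤ ‖(L s).eval z‖} := by
      refine isClosed_le ((hcoeff N).norm.mul continuous_const) ?_
      exact (heval.comp (Continuous.prodMk continuous_id continuous_const)).norm
    have hsub : A ⊆ {s | ‖(L s).coeff N‖ * (-z.re) ^ N ≤ ‖(L s).eval z‖} := by
      intro s' hs'
      have := Polynomial.le_norm_eval_of_roots_re_pos (hN s') hs' hlt
      rwa [Polynomial.leadingCoeff, hN] at this
    have h := closure_minimal hsub hcl hs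
    simp only [Set.mem_ofPred_eq, hz, norm_zero] at h
    have : 0 < ‖(L s).coeff N‖ * (-z.re) ^ N :=
      mul_pos (norm_pos_iff.2 (hlead s)) (pow_pos (by linarith) _)
    linarith
  have huniv := IsClopen.eq_univ ⟨hclosed, hopen⟩ ⟨0, h0⟩
  have h1 : (1 : unitInterval) ∈ A := huniv ▸ Set.mem_univ _
  exact h1

theorem garding {d : ℕ} (F : MvPolynomial (Fin (d + 1)) ℂ)
    (htop : MvPolynomial.eval (Fin.cons 1 0 : Fin (d + 1) → ℂ)
      (MvPolynomial.homogeneousComponent F.totalDegree F) ≠ 0) {C : ℝ} (hC : 0 < C)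
    (hF : ∀ (τ : ℂ) (ξ : Fin d → ℝ),
      MvPolynomial.eval (Fin.cons τ (fun j => (ξ j : ℂ)) : Fin (d + 1) → ℂ) F = 0 → -C ≤ τ.im) :
    ∃ C' : ℝ, 0 < C' ∧ ∀ (τ : ℂ) (ζ : Fin d → ℂ),
      MvPolynomial.eval (Fin.cons τ ζ : Fin (d + 1) → ℂ) F = 0 →
        -C' * (1 + ‖(WithLp.toLp 2 (fun j => (ζ j).im) : Rd d)‖) ≤ τ.im := by
  set G := MvPolynomial.homogeneousComponent F.totalDegree F with hG
  have hcont : Continuous fun e : Rd d =>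
      MvPolynomial.eval (Fin.cons 1 (fun j => (e j : ℂ)) : Fin (d + 1) → ℂ) G := by
    refine (MvPolynomial.continuous_eval G).comp ?_
    refine continuous_pi fun i => ?_
    refine Fin.cases ?_ (fun j => ?_) i
    · simpa using continuous_const
    · simp only [Fin.cons_succ]; fun_prop
  obtain ⟨ε, hε, hball⟩ : ∃ ε > 0, ∀ e : Rd d, ‖e‖ < ε →
      MvPolynomial.eval (Fin.cons 1 (fun j => (e j : ℂ)) : Fin (d + 1) → ℂ) G ≠ 0 := by
    have h0 : MvPolynomial.eval
        (Fin.cons 1 (fun j => ((0 : Rd d) j : ℂ)) : Fin (d + 1) → ℂ) G ≠ 0 := by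
      convert htop using 4
      simp [funext_iff]
    obtain ⟨ε, hε, h⟩ := Metric.eventually_nhds_iff.1 (hcont.continuousAt.eventually_ne h0)
    exact ⟨ε, hε, fun e he => h (by simpa using he)⟩
  refine ⟨C + 1 / ε, by positivity, fun τ ζ h => ?_⟩
  set η : Rd d := WithLp.toLp 2 (fun j => (ζ j).im) with hη
  by_contra! hlt
  set k : ℝ := (‖η‖ + 1) / ε with hk
  have hk0 : 0 < k := by positivity
  have hτ : τ.im + k < -C := by
    have : 1 / ε * (1 + ‖η‖) = k := by rw [hk]; ring
    nlinarith [norm_nonneg η]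
  set e : Rd d := -(k⁻¹ • η) with he
  have he' : ‖e‖ < ε := by
    rw [he, norm_neg, norm_smul, norm_inv, Real.norm_of_nonneg hk0.le, inv_mul_lt_iff₀ hk0, hk,
      div_mul_cancel₀ _ hε.ne']
    linarith
  set p : Fin (d + 1) → ℂ :=
    Fin.cons (τ + k * Complex.I) (fun j => ((ζ j).re : ℂ)) with hp
  set q : unitInterval → Fin (d + 1) → ℂ := fun s =>
    fun i => Complex.I * (Fin.cons 1 (fun j => (((s : ℝ) • e) j : ℂ)) : Fin (d + 1) → ℂ) i with hq
  have hqc : Continuous q := by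
    refine continuous_pi fun i => ?_
    refine Fin.cases ?_ (fun j => ?_) i
    · simpa [hq] using continuous_const
    · simp only [hq, Fin.cons_succ, PiLp.smul_apply, smul_eq_mul]; fun_prop
  have hval : ∀ s z, (lineRestriction p (q s) F).eval z =
      MvPolynomial.eval (Fin.cons (τ + k * Complex.I + z * Complex.I)
        (fun j => ((ζ j).re : ℂ) + z * (Complex.I * (((s : ℝ) • e) j : ℂ))) :
          Fin (d + 1) → ℂ) F := by
    intro s z
    rw [eval_lineRestriction]
    congr 2
    funext i
    refine Fin.cases ?_ (fun j => ?_) i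
    · simp [hp, hq]
    · simp [hp, hq]
  have hmain := roots_re_pos_of_continuous_family (N := F.totalDegree)
    (fun s => lineRestriction p (q s) F)
    (fun k => (continuous_coeff_lineRestriction p F k).comp hqc)
    (fun s => natDegree_lineRestriction_le _ _ _) ?_ ?_ ?_ (-k : ℂ) ?_
  · simp at hmain; linarith
  · intro s
    rw [coeff_totalDegree_lineRestriction, hq,
      (MvPolynomial.homogeneousComponent_isHomogeneous _ F).eval_const_mul]
    refine mul_ne_zero (by simp) (hball _ ?_)
    rw [norm_smul, Real.norm_of_nonneg s.2.1]
    nlinarith [s.2.2, norm_nonneg e]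
  · intro s z hz
    rw [hval]
    intro h0
    have hz' : z = z.im * Complex.I := by apply Complex.ext <;> simp [hz]
    have h1 := hF (τ + k * Complex.I + z * Complex.I)
      (fun j => (ζ j).re - z.im * ((s : ℝ) • e) j) (by
        rw [← h0]
        congr 3
        funext j
        generalize ((s : ℝ) • e) j = x
        push_cast
        linear_combination (-z.im * (x : ℂ)) * Complex.I_mul_I - Complex.I * x * hz')
    simp [hz] at h1
    linarith
  · intro z h0
    rw [hval] at h0
    have h1 := hF (τ + k * Complex.I + z * Complex.I) (fun j => (ζ j).re) (by
        rw [← h0]; congr 3; funext j; simp)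
    simp at h1
    linarith
  · rw [hval, ← h]
    congr 2
    refine congrArg₂ _ (by ring) ?_
    funext j
    have : ((((1 : unitInterval) : ℝ) • e) j : ℝ) = -(k⁻¹ * (ζ j).im) := by simp [he, hη]
    rw [this]
    have hk' : (k : ℂ) ≠ 0 := by exact_mod_cast hk0.ne'
    push_cast
    field_simp
    rw [mul_comm Complex.I, Complex.re_add_im]

theorem refinedHadamardPetrowsky_one_of_isHyperbolic {d m : ℕ} {a : ℕ → MvPolynomial (Fin d) ℂ}
    (hP : IsHyperbolic m a) : RefinedHadamardPetrowsky m a 1 := by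
  obtain ⟨htop, C, hC, h⟩ := hP
  obtain ⟨C', hC', h'⟩ := garding (fullSymbol m a) htop hC
    (fun τ ξ hτ => h τ (WithLp.toLp 2 ξ) hτ)
  exact ⟨C', hC', fun τ ζ hτ => by simpa using h' τ ζ hτ⟩

/-! ### Linear ordinary differential equations with constant coefficients -/

/-- A sequence of functions each of which is the derivative of the previous one. -/
def IsDerivChain (y : ℕ → ℝ → ℂ) : Prop := ∀ k t, HasDerivAt (y k) (y (k + 1) t) t

/-- The pairing `∑ p_k y_k` of a polynomial with a sequence. -/
noncomputable def polyPair (p : Polynomial ℂ) (y : ℕ → ℂ) : ℂ :=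
  Polynomial.lsum (R := ℂ) (fun k => (LinearMap.id : ℂ →ₗ[ℂ] ℂ).smulRight (y k)) p

lemma polyPair_add (p q : Polynomial ℂ) (y : ℕ → ℂ) :
    polyPair (p + q) y = polyPair p y + polyPair q y := map_add _ _ _

lemma polyPair_sub (p q : Polynomial ℂ) (y : ℕ → ℂ) :
    polyPair (p - q) y = polyPair p y - polyPair q y := map_sub _ _ _

lemma polyPair_sum {ι : Type*} (s : Finset ι) (p : ι → Polynomial ℂ) (y : ℕ → ℂ) :
    polyPair (∑ i ∈ s, p i) y = ∑ i ∈ s, polyPair (p i) y := map_sum _ _ _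

lemma polyPair_monomial (n : ℕ) (c : ℂ) (y : ℕ → ℂ) :
    polyPair (Polynomial.monomial n c) y = c * y n := by
  simp [polyPair, Polynomial.lsum_apply, Polynomial.sum_monomial_index]

lemma polyPair_eq_sum (p : Polynomial ℂ) (y : ℕ → ℂ) :
    polyPair p y = ∑ k ∈ p.support, p.coeff k * y k := by
  simp [polyPair, Polynomial.lsum_apply, Polynomial.sum_def]

lemma polyPair_X_sub_C_mul (r : ℂ) (q : Polynomial ℂ) (y : ℕ → ℂ) :
    polyPair ((Polynomial.X - Polynomial.C r) * q) y =
      polyPair q (fun k => y (k + 1) - r * y k) := by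
  induction q using Polynomial.induction_on' with
  | add p q hp hq => rw [mul_add, polyPair_add, polyPair_add, hp, hq]
  | monomial n c =>
    rw [sub_mul, Polynomial.X_mul_monomial, Polynomial.C_mul_monomial, polyPair_sub,
      polyPair_monomial, polyPair_monomial, polyPair_monomial]
    ring

lemma IsDerivChain.shift_sub {y : ℕ → ℝ → ℂ} (hy : IsDerivChain y) (r : ℂ) :
    IsDerivChain fun k t => y (k + 1) t - r * y k t :=
  fun k t => (hy (k + 1) t).sub ((hy k t).const_mul r)

lemma hasDerivAt_exp_mul_chain {y : ℕ → ℝ → ℂ} (hy : IsDerivChain y) (r : ℂ) (t : ℝ) :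
    HasDerivAt (fun s : ℝ => Complex.exp (-r * s) * y 0 s)
      (Complex.exp (-r * t) * (y 1 t - r * y 0 t)) t := by
  have h1 : HasDerivAt (fun s : ℝ => Complex.exp (-r * s)) (Complex.exp (-r * t) * (-r * 1)) t :=
    ((Complex.ofRealCLM.hasDerivAt (x := t)).const_mul (-r)).cexp
  have h2 : HasDerivAt (y 0) (y 1 t) t := hy 0 t
  refine (h1.mul h2).congr_deriv ?_
  ring

/-- A solution of a linear equation which vanishes on a left half-line is zero. -/
lemma IsDerivChain.eq_zero_of_polyPair_eq_zero (s : Multiset ℂ) {y : ℕ → ℝ → ℂ}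
    (hy : IsDerivChain y)
    (hp : ∀ t, polyPair (s.map fun r => Polynomial.X - Polynomial.C r).prod (fun k => y k t) = 0)
    {T₀ : ℝ} (h0 : ∀ k, ∀ t ≤ T₀, y k t = 0) : ∀ t, y 0 t = 0 := by
  induction s using Multiset.induction_on generalizing y with
  | empty =>
    intro t
    have := hp t
    rw [Multiset.map_zero, Multiset.prod_zero, ← Polynomial.C_1, ← Polynomial.monomial_zero_left,
      polyPair_monomial, one_mul] at this
    exact this
  | cons r s ih =>
    have hv := ih (hy.shift_sub r) (fun t => by
      have := hp t
      rwa [Multiset.map_cons, Multiset.prod_cons, polyPair_X_sub_C_mul] at this) (fun k t ht => by simp [h0 _ t ht])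
    intro t
    have hconst := is_const_of_deriv_eq_zero
      (fun t => (hasDerivAt_exp_mul_chain hy r t).differentiableAt)
      (fun t => by rw [(hasDerivAt_exp_mul_chain hy r t).deriv]; simp [hv t]) t T₀
    simp only [h0 0 T₀ le_rfl, mul_zero] at hconst
    exact (mul_eq_zero.1 hconst).resolve_left (Complex.exp_ne_zero _)

/-- A bound for the fundamental solution of a linear equation in terms of its characteristic
exponents. -/
lemma IsDerivChain.norm_le_of_polyPair_eq_zero {n : ℕ} (s : Multiset ℂ) (hs : s.card = n + 1)
    {R : ℝ} (hR : ∀ r ∈ s, r.re ≤ R) {y : ℕ → ℝ → ℂ} (hy : IsDerivChain y)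
    (hp : ∀ t, polyPair (s.map fun r => Polynomial.X - Polynomial.C r).prod (fun k => y k t) = 0)
    (h0 : ∀ k < n, y k 0 = 0) (h1 : y n 0 = 1) {t : ℝ} (ht : 0 ≤ t) :
    ‖y 0 t‖ ≤ t ^ n * Real.exp (R * t) := by
  induction n generalizing s y t with
  | zero =>
    obtain ⟨r, rfl⟩ := Multiset.card_eq_one.1 hs
    have hv : ∀ t, y 1 t - r * y 0 t = 0 := fun t => by
      have := hp t
      rw [Multiset.map_singleton, Multiset.prod_singleton, ← mul_one (_ - _),
        polyPair_X_sub_C_mul, ← Polynomial.C_1, ← Polynomial.monomial_zero_left,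
        polyPair_monomial, one_mul] at this
      exact this
    have hconst := is_const_of_deriv_eq_zero
      (fun t => (hasDerivAt_exp_mul_chain hy r t).differentiableAt)
      (fun t => by rw [(hasDerivAt_exp_mul_chain hy r t).deriv]; simp [hv t]) t 0
    simp only [h1, Complex.ofReal_zero, mul_zero, Complex.exp_zero, mul_one] at hconst
    have hyt : y 0 t = Complex.exp (r * t) := by
      rw [← mul_one (Complex.exp (r * t)), ← hconst, ← mul_assoc, ← Complex.exp_add]
      simp
    rw [hyt, Complex.norm_exp, pow_zero, one_mul]
    have := hR r (by simp)
    simp only [Complex.mul_re, Complex.ofReal_re, Complex.ofReal_im, mul_zero, sub_zero]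
    gcongr
  | succ n ih =>
    obtain ⟨r, s', rfl, hs'⟩ : ∃ r s', s = r ::ₘ s' ∧ s'.card = n + 1 := by
      obtain ⟨r, hr⟩ := Multiset.card_pos_iff_exists_mem.1 (by omega : 0 < s.card)
      obtain ⟨s', rfl⟩ := Multiset.exists_cons_of_mem hr
      exact ⟨r, s', rfl, by simpa using hs⟩
    have hv : ∀ {t : ℝ}, 0 ≤ t → ‖y 1 t - r * y 0 t‖ ≤ t ^ n * Real.exp (R * t) := fun ht =>
      ih s' hs' (fun r hr => hR r (by simp [hr])) (hy.shift_sub r) (fun t => by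
        have := hp t
        rwa [Multiset.map_cons, Multiset.prod_cons, polyPair_X_sub_C_mul] at this)
        (fun k hk => by simp [h0 (k + 1) (by omega), h0 k (by omega)])
        (by simp [h1, h0 n (by omega)]) ht
    have hrR : r.re ≤ R := hR r (by simp)
    have hb := norm_image_sub_le_of_norm_deriv_le_segment'
      (f := fun s : ℝ => Complex.exp (-r * s) * y 0 s) (a := 0) (b := t)
      (C := Real.exp ((R - r.re) * t) * t ^ n)
      (fun x _ => (hasDerivAt_exp_mul_chain hy r x).hasDerivWithinAt)
      (fun x hx => by
        rw [norm_mul, Complex.norm_exp]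
        have e1 : (-r * (x : ℂ)).re = -r.re * x := by simp
        rw [e1]
        calc Real.exp (-r.re * x) * ‖y 1 x - r * y 0 x‖
            ≤ Real.exp (-r.re * x) * (x ^ n * Real.exp (R * x)) := by
              gcongr; exact hv hx.1
          _ = Real.exp ((R - r.re) * x) * x ^ n := by
              rw [mul_comm (x ^ n), ← mul_assoc, ← Real.exp_add]; ring_nf
          _ ≤ _ := by
              have := hx.1
              have := hx.2.le
              have : 0 ≤ R - r.re := by linarith
              gcongr) t (Set.right_mem_Icc.2 ht)
    simp only [h0 0 (by omega), mul_zero, sub_zero] at hb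
    rw [norm_mul, Complex.norm_exp] at hb
    have e1 : (-r * (t : ℂ)).re = -r.re * t := by simp
    rw [e1] at hb
    calc ‖y 0 t‖ = Real.exp (r.re * t) * (Real.exp (-r.re * t) * ‖y 0 t‖) := by
          rw [← mul_assoc, ← Real.exp_add]; simp
      _ ≤ Real.exp (r.re * t) * (Real.exp ((R - r.re) * t) * t ^ n * t) := by gcongr
      _ = t ^ (n + 1) * Real.exp (R * t) := by
          have : Real.exp (R * t) = Real.exp (r.re * t) * Real.exp ((R - r.re) * t) := by
            rw [← Real.exp_add]; ring_nf
          rw [this]; ring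

/-! ### The fundamental solution via the companion operator -/

/-- The monic polynomial `X ^ (n + 1) + ∑ c_j X ^ j`. -/
noncomputable def monicPoly {n : ℕ} (c : Fin (n + 1) → ℂ) : Polynomial ℂ :=
  Polynomial.monomial (n + 1) 1 + ∑ j : Fin (n + 1), Polynomial.monomial (j : ℕ) (c j)

lemma polyPair_monicPoly {n : ℕ} (c : Fin (n + 1) → ℂ) (y : ℕ → ℂ) :
    polyPair (monicPoly c) y = y (n + 1) + ∑ j : Fin (n + 1), c j * y j := by
  simp [monicPoly, polyPair_add, polyPair_sum, polyPair_monomial]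

lemma eval_monicPoly {n : ℕ} (c : Fin (n + 1) → ℂ) (z : ℂ) :
    (monicPoly c).eval z = z ^ (n + 1) + ∑ j : Fin (n + 1), c j * z ^ (j : ℕ) := by
  simp [monicPoly, Polynomial.eval_finsetSum]

lemma degree_sum_monomial_lt {n : ℕ} (c : Fin (n + 1) → ℂ) :
    (∑ j : Fin (n + 1), Polynomial.monomial (j : ℕ) (c j)).degree < ((n + 1 : ℕ) : WithBot ℕ) := by
  refine lt_of_le_of_lt (Polynomial.degree_sum_le _ _) ((Finset.sup_lt_iff ?_).2 fun j _ => ?_)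
  · exact WithBot.bot_lt_coe _
  · exact lt_of_le_of_lt (Polynomial.degree_monomial_le _ _) (by exact_mod_cast j.2)

lemma monic_monicPoly {n : ℕ} (c : Fin (n + 1) → ℂ) : (monicPoly c).Monic := by
  unfold monicPoly
  rw [← Polynomial.X_pow_eq_monomial]
  exact Polynomial.monic_X_pow_add (degree_sum_monomial_lt c)

lemma natDegree_monicPoly {n : ℕ} (c : Fin (n + 1) → ℂ) : (monicPoly c).natDegree = n + 1 := by
  unfold monicPoly
  rw [← Polynomial.X_pow_eq_monomial]
  refine Polynomial.natDegree_eq_of_degree_eq_some ?_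
  rw [Polynomial.degree_add_eq_left_of_degree_lt, Polynomial.degree_X_pow]
  rw [Polynomial.degree_X_pow]
  exact degree_sum_monomial_lt c

lemma monicPoly_eq_prod_roots {n : ℕ} (c : Fin (n + 1) → ℂ) :
    ((monicPoly c).roots.map fun r => Polynomial.X - Polynomial.C r).prod = monicPoly c :=
  ((IsAlgClosed.splits _).eq_prod_roots_of_monic (monic_monicPoly c)).symm

lemma card_roots_monicPoly {n : ℕ} (c : Fin (n + 1) → ℂ) :
    (monicPoly c).roots.card = n + 1 := by
  rw [← (IsAlgClosed.splits _).natDegree_eq_card_roots, natDegree_monicPoly]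

section BanachAlgebra

variable {𝔸 : Type*} [NormedRing 𝔸] [NormedAlgebra ℂ 𝔸] [CompleteSpace 𝔸]

lemma isDerivChain_exp (ℓ : 𝔸 →L[ℂ] ℂ) (A : 𝔸) :
    IsDerivChain fun k t => ℓ (A ^ k * NormedSpace.exp ((t : ℂ) • A)) := by
  intro k t
  have h1 : HasDerivAt (fun u : ℂ => A ^ k * NormedSpace.exp (u • A))
      (A ^ k * (A * NormedSpace.exp ((t : ℂ) • A))) (t : ℂ) :=
    (hasDerivAt_exp_smul_const' A (t : ℂ)).const_mul _
  have h2 := (ℓ.hasFDerivAt.comp_hasDerivAt (t : ℂ) h1).comp_ofReal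
  rw [← mul_assoc, ← pow_succ] at h2
  exact h2

lemma differentiable_exp_smul (ℓ : 𝔸 →L[ℂ] ℂ) (t : ℂ) :
    Differentiable ℂ fun A : 𝔸 => ℓ (NormedSpace.exp (t • A)) := fun A =>
  ℓ.differentiableAt.comp A ((NormedSpace.exp_analytic (𝕂 := ℂ) _).differentiableAt.comp A
    (differentiableAt_id.const_smul t))

end BanachAlgebra

/-- The companion matrix of `monicPoly c`. -/
def companionMatrix {n : ℕ} (c : Fin (n + 1) → ℂ) : Matrix (Fin (n + 1)) (Fin (n + 1)) ℂ :=
  fun i j => if (i : ℕ) + 1 = j then 1 else if i = Fin.last n then -c j else 0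

lemma companionMatrix_mul_apply_of_lt {n : ℕ} (c : Fin (n + 1) → ℂ)
    (M : Matrix (Fin (n + 1)) (Fin (n + 1)) ℂ) {i : ℕ} (hi : i + 1 < n + 1) (l : Fin (n + 1)) :
    (companionMatrix c * M) ⟨i, by omega⟩ l = M ⟨i + 1, hi⟩ l := by
  have hne : (⟨i, by omega⟩ : Fin (n + 1)) ≠ Fin.last n := by
    intro h; have := congrArg Fin.val h; simp at this; omega
  rw [Matrix.mul_apply, Finset.sum_eq_single ⟨i + 1, hi⟩]
  · simp [companionMatrix]
  · intro j _ hj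
    have : i + 1 ≠ j := fun h => hj (Fin.ext h.symm)
    simp [companionMatrix, hne, this]
  · simp

lemma companionMatrix_mul_apply_last {n : ℕ} (c : Fin (n + 1) → ℂ)
    (M : Matrix (Fin (n + 1)) (Fin (n + 1)) ℂ) (l : Fin (n + 1)) :
    (companionMatrix c * M) (Fin.last n) l = -∑ j, c j * M j l := by
  rw [Matrix.mul_apply, ← Finset.sum_neg_distrib]
  refine Finset.sum_congr rfl fun j _ => ?_
  have : n + 1 ≠ j := by omega
  simp [companionMatrix, this]

lemma companionMatrix_pow_mul_apply_zero {n : ℕ} (c : Fin (n + 1) → ℂ)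
    (M : Matrix (Fin (n + 1)) (Fin (n + 1)) ℂ) {k : ℕ} (hk : k < n + 1) (l : Fin (n + 1)) :
    (companionMatrix c ^ k * M) 0 l = M ⟨k, hk⟩ l := by
  induction k generalizing M with
  | zero => simp
  | succ k ih =>
    rw [pow_succ, mul_assoc, ih _ (by omega), companionMatrix_mul_apply_of_lt c M hk]

section MatrixNorm

attribute [local instance] Matrix.linftyOpNormedRing Matrix.linftyOpNormedAlgebra

/-- The fundamental solution of `monicPoly c (∂_t)` and its derivatives. -/
noncomputable def fundChain {n : ℕ} (c : Fin (n + 1) → ℂ) (k : ℕ) (t : ℝ) : ℂ :=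
  (companionMatrix c ^ k * NormedSpace.exp ((t : ℂ) • companionMatrix c)) 0 (Fin.last n)

/-- The functional `M ↦ M 0 n` on matrices. -/
noncomputable def cornerCLM (n : ℕ) : Matrix (Fin (n + 1)) (Fin (n + 1)) ℂ →L[ℂ] ℂ :=
  LinearMap.toContinuousLinearMap (Matrix.entryLinearMap ℂ ℂ 0 (Fin.last n))

lemma isDerivChain_fundChain {n : ℕ} (c : Fin (n + 1) → ℂ) : IsDerivChain (fundChain c) :=
  isDerivChain_exp (cornerCLM n) (companionMatrix c)

lemma differentiable_companionMatrix {n : ℕ} :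
    Differentiable ℂ (companionMatrix : (Fin (n + 1) → ℂ) → _) := by
  have : (companionMatrix : (Fin (n + 1) → ℂ) → _) = fun c =>
      companionMatrix 0 + ∑ j, c j • Matrix.single (Fin.last n) j (-1 : ℂ) := by
    funext c
    ext i l
    rw [Matrix.add_apply, Matrix.sum_apply, Finset.sum_eq_single l]
    · simp only [companionMatrix, Matrix.smul_apply, Matrix.single_apply]
      by_cases hi : i = Fin.last n
      · subst hi
        have : n + 1 ≠ l := by omega
        simp [this]
      · simp [hi, Ne.symm hi]
    · intro j _ hj
      simp [hj]
    · simp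
  rw [this]
  refine (differentiable_const _).add ?_
  exact Differentiable.fun_sum fun j _ => (differentiable_apply j).smul_const _

lemma differentiable_fundChain {n : ℕ} (t : ℝ) :
    Differentiable ℂ fun c : Fin (n + 1) → ℂ => fundChain c 0 t := by
  have := (differentiable_exp_smul (cornerCLM n) (t : ℂ)).comp
    (differentiable_companionMatrix (n := n))
  have h : (fun c : Fin (n + 1) → ℂ => fundChain c 0 t) =
      (fun A => cornerCLM n (NormedSpace.exp ((t : ℂ) • A))) ∘ companionMatrix := by
    funext c
    simp [fundChain, cornerCLM]
  rw [h]
  exact this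

end MatrixNorm

lemma polyPair_fundChain {n : ℕ} (c : Fin (n + 1) → ℂ) (t : ℝ) :
    polyPair (monicPoly c) (fun k => fundChain c k t) = 0 := by
  rw [polyPair_monicPoly]
  unfold fundChain
  set w := NormedSpace.exp ((t : ℂ) • companionMatrix c)
  rw [pow_succ, mul_assoc, companionMatrix_pow_mul_apply_zero c _ (Nat.lt_succ_self n)]
  have := companionMatrix_mul_apply_last c w (Fin.last n)
  rw [Fin.last] at this ⊢
  rw [this, neg_add_eq_zero]
  exact Finset.sum_congr rfl fun j _ => by
    rw [companionMatrix_pow_mul_apply_zero c w j.2]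

lemma fundChain_zero_right {n : ℕ} (c : Fin (n + 1) → ℂ) {k : ℕ} (hk : k < n + 1) :
    fundChain c k 0 = if k = n then 1 else 0 := by
  unfold fundChain
  rw [companionMatrix_pow_mul_apply_zero c _ hk, Complex.ofReal_zero, zero_smul,
    NormedSpace.exp_zero]
  simp [Matrix.one_apply, Fin.ext_iff]

lemma norm_fundChain_le {n : ℕ} (c : Fin (n + 1) → ℂ) {R : ℝ}
    (hR : ∀ r, (monicPoly c).eval r = 0 → r.re ≤ R) {t : ℝ} (ht : 0 ≤ t) :
    ‖fundChain c 0 t‖ ≤ t ^ n * Real.exp (R * t) := by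
  refine (isDerivChain_fundChain c).norm_le_of_polyPair_eq_zero (monicPoly c).roots
    (card_roots_monicPoly c) (fun r hr => hR r ?_) (fun t => ?_) (fun k hk => ?_) ?_ ht
  · exact (Polynomial.mem_roots (monic_monicPoly c).ne_zero).1 hr
  · rw [monicPoly_eq_prod_roots, polyPair_fundChain]
  · rw [fundChain_zero_right c (by omega), if_neg (by omega)]
  · rw [fundChain_zero_right c (by omega), if_pos rfl]

/-! ### Weak solutions -/

lemma hasDerivAt_polyPair (p : Polynomial ℂ) {W W' : ℕ → ℝ → ℂ} {t : ℝ}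
    (h : ∀ k, HasDerivAt (W k) (W' k t) t) :
    HasDerivAt (fun t => polyPair p fun k => W k t) (polyPair p fun k => W' k t) t := by
  simp only [polyPair_eq_sum]
  exact HasDerivAt.fun_sum fun k _ => (h k).const_mul _

/-- The boundary terms in the formula of integration by parts. -/
noncomputable def boundaryTerm (y φ : ℕ → ℝ → ℂ) (k : ℕ) (t : ℝ) : ℂ :=
  ∑ i ∈ Finset.range k, (-1) ^ i * (y (k - 1 - i) t * φ i t)

lemma hasDerivAt_boundaryTerm {y φ : ℕ → ℝ → ℂ} (hy : IsDerivChain y) (hφ : IsDerivChain φ)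
    (k : ℕ) (t : ℝ) :
    HasDerivAt (boundaryTerm y φ k) (y k t * φ 0 t - y 0 t * ((-1) ^ k * φ k t)) t := by
  have h : HasDerivAt (boundaryTerm y φ k) (∑ i ∈ Finset.range k,
      (-1) ^ i * (y (k - 1 - i + 1) t * φ i t + y (k - 1 - i) t * φ (i + 1) t)) t :=
    HasDerivAt.fun_sum fun i _ => ((hy _ t).mul (hφ i t)).const_mul _
  refine h.congr_deriv ?_
  have h2 : ∀ i ∈ Finset.range k,
      (-1 : ℂ) ^ i * (y (k - 1 - i + 1) t * φ i t + y (k - 1 - i) t * φ (i + 1) t) =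
      (-1) ^ i * (y (k - i) t * φ i t) - (-1) ^ (i + 1) * (y (k - (i + 1)) t * φ (i + 1) t) := by
    intro i hi
    have hi' := Finset.mem_range.1 hi
    rw [show k - 1 - i + 1 = k - i by omega, show k - 1 - i = k - (i + 1) by omega]
    ring
  rw [Finset.sum_congr rfl h2,
    Finset.sum_range_sub' (fun i => (-1 : ℂ) ^ i * (y (k - i) t * φ i t))]
  simp
  ring

lemma polyPair_mul_sub (p : Polynomial ℂ) (y φ : ℕ → ℂ) :
    polyPair p (fun k => y k * φ 0 - y 0 * ((-1) ^ k * φ k)) =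
      φ 0 * polyPair p y - y 0 * polyPair p (fun k => (-1) ^ k * φ k) := by
  simp only [polyPair_eq_sum, Finset.mul_sum, ← Finset.sum_sub_distrib]
  exact Finset.sum_congr rfl fun k _ => by ring

lemma isDerivChain_iteratedDeriv {φ : ℝ → ℂ} (hφ : ContDiff ℝ ∞ φ) :
    IsDerivChain fun k => iteratedDeriv k φ := by
  intro k t
  have := (hφ.differentiable_iteratedDeriv k (by exact_mod_cast ENat.natCast_lt_top k)) t
  have h := this.hasDerivAt
  rwa [← iteratedDeriv_succ] at h

lemma HasCompactSupport.iteratedDeriv {φ : ℝ → ℂ} (hφ : HasCompactSupport φ) (k : ℕ) :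
    HasCompactSupport (iteratedDeriv k φ) := by
  induction k with
  | zero => simpa using hφ
  | succ k ih => rw [iteratedDeriv_succ]; exact ih.deriv

lemma HasCompactSupport.exists_forall_abs_gt {φ : ℝ → ℂ} (hφ : HasCompactSupport φ) :
    ∃ M : ℝ, ∀ k t, M < |t| → _root_.iteratedDeriv k φ t = 0 := by
  obtain ⟨M, hM⟩ := hφ.isCompact.isBounded.subset_closedBall 0
  refine ⟨M, fun k t ht => ?_⟩
  have hopen : IsOpen (Metric.closedBall (0 : ℝ) M)ᶜ := Metric.isClosed_closedBall.isOpen_compl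
  have h : φ =ᶠ[nhds t] fun _ => 0 := by
    filter_upwards [hopen.mem_nhds (show t ∈ (Metric.closedBall (0 : ℝ) M)ᶜ by simpa using ht)]
      with s hs
    exact image_eq_zero_of_notMem_tsupport fun h => hs (hM h)
  rw [h.iteratedDeriv_eq k, iteratedDeriv_const]
  simp

lemma continuous_polyPair_iteratedDeriv (p : Polynomial ℂ) {φ : ℝ → ℂ} (hφ : ContDiff ℝ ∞ φ) :
    Continuous fun t => polyPair p fun k => (-1) ^ k * iteratedDeriv k φ t := by
  simp only [polyPair_eq_sum]
  refine continuous_finsetSum _ fun k _ => continuous_const.mul (continuous_const.mul ?_)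
  exact hφ.continuous_iteratedDeriv k (by exact_mod_cast le_top)

lemma hasCompactSupport_polyPair_iteratedDeriv (p : Polynomial ℂ) {φ : ℝ → ℂ}
    (hφ : HasCompactSupport φ) :
    HasCompactSupport fun t => polyPair p fun k => (-1) ^ k * iteratedDeriv k φ t := by
  obtain ⟨M, hM⟩ := hφ.exists_forall_abs_gt
  refine HasCompactSupport.of_support_subset_isCompact (isCompact_closedBall (0 : ℝ) M) ?_
  intro t ht
  by_contra hlt
  refine ht ?_
  simp [polyPair_eq_sum, hM _ t (by simpa using hlt)]

/-- The function equal to the fundamental solution on `[0, ∞)` and to zero on `(-∞, 0)`. -/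
noncomputable def forwardSolution {n : ℕ} (c : Fin (n + 1) → ℂ) (t : ℝ) : ℂ :=
  (Set.Ici 0).indicator (fundChain c 0) t

lemma boundaryTerm_fundChain_zero {n : ℕ} (c : Fin (n + 1) → ℂ) (φ : ℕ → ℝ → ℂ) {k : ℕ}
    (hk : k ≤ n + 1) :
    boundaryTerm (fundChain c) φ k 0 = if k = n + 1 then φ 0 0 else 0 := by
  unfold boundaryTerm
  have h : ∀ i ∈ Finset.range k, (-1 : ℂ) ^ i * (fundChain c (k - 1 - i) 0 * φ i 0) =
      if i = 0 ∧ k = n + 1 then φ 0 0 else 0 := by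
    intro i hi
    have hi' := Finset.mem_range.1 hi
    rw [fundChain_zero_right c (by omega)]
    by_cases h : i = 0 ∧ k = n + 1
    · obtain ⟨rfl, rfl⟩ := h; simp
    · rw [if_neg (by omega), if_neg h]; simp
  rw [Finset.sum_congr rfl h]
  by_cases hk' : k = n + 1
  · subst hk'; simp
  · simp [hk']

lemma integral_forwardSolution {n : ℕ} (c : Fin (n + 1) → ℂ) {φ : ℝ → ℂ}
    (hφ : ContDiff ℝ ∞ φ) (hφc : HasCompactSupport φ) :
    ∫ t, forwardSolution c t *
      polyPair (monicPoly c) (fun k => (-1) ^ k * iteratedDeriv k φ t) = φ 0 := by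
  set Φ : ℕ → ℝ → ℂ := fun k => iteratedDeriv k φ with hΦ
  have hchain : IsDerivChain Φ := isDerivChain_iteratedDeriv hφ
  have hderiv : ∀ t, HasDerivAt
      (fun t => polyPair (monicPoly c) fun k => boundaryTerm (fundChain c) Φ k t)
      (-(fundChain c 0 t * polyPair (monicPoly c) fun k => (-1) ^ k * Φ k t)) t := by
    intro t
    have := hasDerivAt_polyPair (monicPoly c) (t := t)
      (W' := fun k t => fundChain c k t * Φ 0 t - fundChain c 0 t * ((-1) ^ k * Φ k t))
      (fun k => hasDerivAt_boundaryTerm (isDerivChain_fundChain c) hchain k t)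
    refine this.congr_deriv ?_
    rw [polyPair_mul_sub _ (fun k => fundChain c k t) (fun k => Φ k t), polyPair_fundChain]
    ring
  have hcont : Continuous (fundChain c 0) :=
    continuous_iff_continuousAt.2 fun t => (isDerivChain_fundChain c 0 t).continuousAt
  have hint : MeasureTheory.Integrable fun t =>
      -(fundChain c 0 t * polyPair (monicPoly c) fun k => (-1) ^ k * Φ k t) :=
    ((hcont.mul (continuous_polyPair_iteratedDeriv _ hφ)).integrable_of_hasCompactSupport
      (hasCompactSupport_polyPair_iteratedDeriv _ hφc).mul_left).neg
  obtain ⟨M, hM⟩ := hφc.exists_forall_abs_gt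
  have hlim : Filter.Tendsto
      (fun t => polyPair (monicPoly c) fun k => boundaryTerm (fundChain c) Φ k t)
      Filter.atTop (nhds 0) := by
    refine tendsto_const_nhds.congr' ?_
    filter_upwards [Filter.eventually_gt_atTop M] with t ht
    have : ∀ k, Φ k t = 0 := fun k => hM k t (ht.trans_le (le_abs_self t))
    simp [polyPair_eq_sum, boundaryTerm, this]
  have key := MeasureTheory.integral_Ioi_of_hasDerivAt_of_tendsto' (a := 0)
    (fun t _ => hderiv t) hint.integrableOn hlim
  have hzero : (polyPair (monicPoly c) fun k => boundaryTerm (fundChain c) Φ k 0) = φ 0 := by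
    rw [polyPair_monicPoly, boundaryTerm_fundChain_zero c Φ le_rfl, Finset.sum_eq_zero]
    · simp [hΦ]
    · intro j _
      rw [boundaryTerm_fundChain_zero c Φ (by omega), if_neg (by omega), mul_zero]
  rw [hzero, MeasureTheory.integral_neg, zero_sub, neg_inj,
    ← MeasureTheory.integral_Ici_eq_integral_Ioi,
    ← MeasureTheory.integral_indicator measurableSet_Ici] at key
  rw [← key]
  refine MeasureTheory.integral_congr_ae (Filter.Eventually.of_forall fun t => ?_)
  by_cases ht : t ∈ Set.Ici (0 : ℝ) <;> simp [forwardSolution, ht, hΦ]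

lemma locallyIntegrable_of_continuousOn_Ici {v : ℝ → ℂ} (h0 : ∀ t < 0, v t = 0)
    (hc : ContinuousOn v (Set.Ici 0)) : MeasureTheory.LocallyIntegrable v := by
  have h1 : Continuous fun t => v (max t 0) := by
    rw [← continuousOn_univ]
    exact hc.comp (by fun_prop) fun t _ => le_max_right t 0
  have h2 : v = (Set.Ici 0).indicator fun t => v (max t 0) := by
    funext t
    by_cases ht : t ∈ Set.Ici (0 : ℝ)
    · rw [Set.indicator_of_mem ht, max_eq_left ht]
    · rw [Set.indicator_of_notMem ht, h0 t (by simpa using ht)]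
  rw [h2]
  exact h1.locallyIntegrable.indicator measurableSet_Ici

lemma integral_mul_eq_zero_of_weak_eq_zero {n : ℕ} (c : Fin (n + 1) → ℂ) {v : ℝ → ℂ}
    (h0 : ∀ t < 0, v t = 0) (hv : MeasureTheory.LocallyIntegrable v)
    (hw : ∀ φ : ℝ → ℂ, ContDiff ℝ ∞ φ → HasCompactSupport φ →
      ∫ t, v t * polyPair (monicPoly c) (fun k => (-1) ^ k * iteratedDeriv k φ t) = 0)
    {ρ : ℝ → ℂ} (hρ : ContDiff ℝ ∞ ρ) (hρc : HasCompactSupport ρ) :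
    ∫ t, v t * ρ (-t) = 0 := by
  set y : ℕ → ℝ → ℂ := fun k x => ∫ t, v t * iteratedDeriv k ρ (x - t) with hy
  have hk : ∀ k, ContDiff ℝ 1 (iteratedDeriv k ρ) := fun k => by
    rw [iteratedDeriv_eq_iterate]
    exact (hρ.iterate_deriv k).of_le (by exact_mod_cast le_top)
  have hchain : IsDerivChain y := by
    intro k x
    have := (hρc.iteratedDeriv k).hasDerivAt_convolution_right (ContinuousLinearMap.mul ℝ ℂ)
      hv (hk k) x
    rw [← iteratedDeriv_succ] at this
    exact this
  have hint : ∀ k x, MeasureTheory.Integrable fun t => v t * iteratedDeriv k ρ (x - t) := by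
    intro k x
    refine hv.integrable_smul_right_of_hasCompactSupport ((hk k).continuous.comp (by fun_prop)) ?_
    exact (hρc.iteratedDeriv k).comp_homeomorph (Homeomorph.subLeft x)
  obtain ⟨M, hM⟩ := hρc.exists_forall_abs_gt
  have h := hchain.eq_zero_of_polyPair_eq_zero (monicPoly c).roots (T₀ := -|M| - 1) ?_ ?_ 0
  · simpa [hy] using h
  · intro x
    rw [monicPoly_eq_prod_roots, ← hw (fun t => ρ (x - t)) (hρ.comp (by fun_prop))
      (hρc.comp_homeomorph (Homeomorph.subLeft x))]
    simp only [polyPair_eq_sum, hy, Finset.mul_sum]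
    rw [MeasureTheory.integral_finsetSum]
    · refine Finset.sum_congr rfl fun k _ => ?_
      rw [← MeasureTheory.integral_const_mul]
      refine MeasureTheory.integral_congr_ae (Filter.Eventually.of_forall fun t => ?_)
      simp only [iteratedDeriv_comp_const_sub, Complex.real_smul]
      have : (-1 : ℂ) ^ k * (-1) ^ k = 1 := by rw [← mul_pow]; simp
      push_cast
      linear_combination -(monicPoly c).coeff k * v t * iteratedDeriv k ρ (x - t) * this
    · intro k _
      have := ((hint k x).const_mul ((monicPoly c).coeff k))
      refine this.congr (Filter.Eventually.of_forall fun t => ?_)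
      simp only [iteratedDeriv_comp_const_sub, Complex.real_smul]
      have : (-1 : ℂ) ^ k * (-1) ^ k = 1 := by rw [← mul_pow]; simp
      push_cast
      linear_combination -(monicPoly c).coeff k * v t * iteratedDeriv k ρ (x - t) * this
  · intro k x hx
    simp only [hy]
    refine MeasureTheory.integral_eq_zero_of_ae (Filter.Eventually.of_forall fun t => ?_)
    rcases lt_or_ge t 0 with ht | ht
    · simp [h0 t ht]
    · have : M < |x - t| := by
        rw [abs_of_neg (by have := abs_nonneg M; linarith)]
        have := le_abs_self M
        linarith
      simp [hM k _ this]

lemma eq_of_weak_eq {n : ℕ} (c : Fin (n + 1) → ℂ) {u v : ℝ → ℂ}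
    (hu0 : ∀ t < 0, u t = 0) (hv0 : ∀ t < 0, v t = 0)
    (hu : ContinuousOn u (Set.Ici 0)) (hv : ContinuousOn v (Set.Ici 0))
    (hw : ∀ φ : ℝ → ℂ, ContDiff ℝ ∞ φ → HasCompactSupport φ →
      ∫ t, u t * polyPair (monicPoly c) (fun k => (-1) ^ k * iteratedDeriv k φ t) =
      ∫ t, v t * polyPair (monicPoly c) (fun k => (-1) ^ k * iteratedDeriv k φ t)) :
    u = v := by
  have hui := locallyIntegrable_of_continuousOn_Ici hu0 hu
  have hvi := locallyIntegrable_of_continuousOn_Ici hv0 hv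
  have hae : ∀ᵐ t, (u - v) t = 0 := by
    refine ae_eq_zero_of_integral_contDiff_smul_eq_zero (hui.sub hvi) fun g hg hgc => ?_
    have hg' : ContDiff ℝ ∞ fun t => ((g (-t) : ℝ) : ℂ) :=
      Complex.ofRealCLM.contDiff.comp (hg.comp contDiff_neg)
    have hgc' : HasCompactSupport fun t => ((g (-t) : ℝ) : ℂ) :=
      (hgc.comp_homeomorph (Homeomorph.neg ℝ)).comp_left (g := fun x : ℝ => (x : ℂ)) (by simp)
    have := integral_mul_eq_zero_of_weak_eq_zero c (v := u - v)
      (fun t ht => by simp [hu0 t ht, hv0 t ht]) (hui.sub hvi) (fun φ hφ hφc => ?_) hg' hgc'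
    · rw [← this]
      refine MeasureTheory.integral_congr_ae (Filter.Eventually.of_forall fun t => ?_)
      simp [mul_comm]
    · have hφ1 := continuous_polyPair_iteratedDeriv (monicPoly c) hφ
      have hφ2 := hasCompactSupport_polyPair_iteratedDeriv (monicPoly c) hφc
      have hsub := hw φ hφ hφc
      have hi1 := hui.integrable_smul_right_of_hasCompactSupport hφ1 hφ2
      have hi2 := hvi.integrable_smul_right_of_hasCompactSupport hφ1 hφ2
      simp only [smul_eq_mul] at hi1 hi2
      rw [← sub_eq_zero, ← MeasureTheory.integral_sub hi1 hi2] at hsub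
      rw [← hsub]
      refine MeasureTheory.integral_congr_ae (Filter.Eventually.of_forall fun t => ?_)
      simp [sub_mul]
  have hae' : u =ᵐ[MeasureTheory.volume.restrict (Set.Ici 0)] v :=
    MeasureTheory.ae_restrict_of_ae (hae.mono fun t ht => sub_eq_zero.1 ht)
  have hon := MeasureTheory.Measure.eqOn_of_ae_eq hae' hu hv (by
    rw [interior_Ici, closure_Ioi])
  funext t
  rcases lt_or_ge t 0 with ht | ht
  · rw [hu0 t ht, hv0 t ht]
  · exact hon ht

/-! ### The fundamental symbol of an operator -/

/-- The coefficients of the polynomial `P(·, ζ)`, in increasing order of degree. -/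
noncomputable def symbolCoeff {d : ℕ} (n : ℕ) (a : ℕ → MvPolynomial (Fin d) ℂ) (ζ : Fin d → ℂ) :
    Fin (n + 1) → ℂ :=
  fun j => MvPolynomial.eval ζ (a (n + 1 - j))

lemma sum_Icc_one_eq_sum_fin (n : ℕ) (f : ℕ → ℕ → ℂ) :
    ∑ k ∈ Finset.Icc 1 (n + 1), f k (n + 1 - k) = ∑ j : Fin (n + 1), f (n + 1 - j) j := by
  rw [Fin.sum_univ_eq_sum_range (fun j => f (n + 1 - j) j)]
  refine Finset.sum_nbij' (fun k => n + 1 - k) (fun j => n + 1 - j) ?_ ?_ ?_ ?_ ?_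
  · intro k hk; rw [Finset.mem_Icc] at hk; rw [Finset.mem_range]; omega
  · intro k hk; rw [Finset.mem_range] at hk; rw [Finset.mem_Icc]; omega
  · intro k hk; rw [Finset.mem_Icc] at hk; omega
  · intro k hk; rw [Finset.mem_range] at hk; omega
  · intro k hk
    rw [Finset.mem_Icc] at hk
    rw [show n + 1 - (n + 1 - k) = k by omega]

lemma symbolValue_eq_eval_monicPoly {d : ℕ} (n : ℕ) (a : ℕ → MvPolynomial (Fin d) ℂ) (τ : ℂ)
    (ζ : Fin d → ℂ) :
    symbolValue (n + 1) a τ ζ = (monicPoly (symbolCoeff n a ζ)).eval (Complex.I * τ) := by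
  rw [eval_monicPoly]
  simp only [symbolCoeff]
  rw [← sum_Icc_one_eq_sum_fin n fun k j => MvPolynomial.eval ζ (a k) * (Complex.I * τ) ^ j]
  simp [symbolValue, fullSymbol, MvPolynomial.eval_rename, Function.comp_def]

lemma polyPair_symbolCoeff {d : ℕ} (n : ℕ) (a : ℕ → MvPolynomial (Fin d) ℂ) (ζ : Fin d → ℂ)
    (φ : ℝ → ℂ) (t : ℝ) :
    polyPair (monicPoly (symbolCoeff n a ζ)) (fun k => (-1) ^ k * iteratedDeriv k φ t) =
      (-1) ^ (n + 1) * iteratedDeriv (n + 1) φ t +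
      ∑ k ∈ Finset.Icc 1 (n + 1), MvPolynomial.eval ζ (a k) *
        ((-1) ^ (n + 1 - k) * iteratedDeriv (n + 1 - k) φ t) := by
  rw [polyPair_monicPoly]
  simp only [symbolCoeff]
  rw [sum_Icc_one_eq_sum_fin n fun k j =>
    MvPolynomial.eval ζ (a k) * ((-1) ^ j * iteratedDeriv j φ t)]

/-- The value at `t` and at a complex frequency `ζ` of the fundamental solution. -/
noncomputable def complexSymbol {d : ℕ} (n : ℕ) (a : ℕ → MvPolynomial (Fin d) ℂ) (t : ℝ)
    (ζ : Fin d → ℂ) : ℂ :=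
  fundChain (symbolCoeff n a ζ) 0 t

lemma continuous_complexSymbol {d : ℕ} (n : ℕ) (a : ℕ → MvPolynomial (Fin d) ℂ) (t : ℝ) :
    Continuous (complexSymbol n a t) :=
  (differentiable_fundChain t).continuous.comp
    (continuous_pi fun j => MvPolynomial.continuous_eval (a (n + 1 - j)))

lemma MvPolynomial.differentiable_eval_comp {ι : Type*} (F : MvPolynomial ι ℂ)
    {f : ℂ → ι → ℂ} (hf : ∀ i, Differentiable ℂ fun z => f z i) :
    Differentiable ℂ fun z => MvPolynomial.eval (f z) F := by
  induction F using MvPolynomial.induction_on with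
  | C c => simp
  | add F G hF hG =>
    simp only [map_add]
    exact hF.add hG
  | mul_X F i hF =>
    simp only [map_mul, MvPolynomial.eval_X]
    exact hF.mul (hf i)

lemma differentiable_complexSymbol_comp {d : ℕ} (n : ℕ) (a : ℕ → MvPolynomial (Fin d) ℂ) (t : ℝ)
    {f : ℂ → Fin d → ℂ} (hf : ∀ i, Differentiable ℂ fun z => f z i) :
    Differentiable ℂ fun z => complexSymbol n a t (f z) :=
  (differentiable_fundChain t).comp (differentiable_pi.2 fun j =>
    MvPolynomial.differentiable_eval_comp (a (n + 1 - j)) hf)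

lemma RefinedHadamardPetrowsky.norm_complexSymbol_le {d n : ℕ}
    {a : ℕ → MvPolynomial (Fin d) ℂ} (h : RefinedHadamardPetrowsky (n + 1) a 1) (T : ℝ) :
    ∃ C M : ℝ, 0 < C ∧ 0 < M ∧ ∀ t ∈ Set.Icc 0 T, ∀ ζ : Fin d → ℂ, ‖complexSymbol n a t ζ‖ ≤
      M * Real.exp (C * ‖(WithLp.toLp 2 (fun j => (ζ j).im) : Rd d)‖) := by
  obtain ⟨C, hC, h⟩ := h
  rcases lt_or_ge T 0 with hT | hT
  · refine ⟨1, 1, one_pos, one_pos, fun t ht => ?_⟩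
    exact absurd (ht.1.trans ht.2) (not_le.2 hT)
  refine ⟨C * (T + 1), (T + 1) ^ n * Real.exp (C * T), by positivity, by positivity,
    fun t ht ζ => ?_⟩
  set r := ‖(WithLp.toLp 2 (fun j => (ζ j).im) : Rd d)‖ with hr
  have hr0 : 0 ≤ r := norm_nonneg _
  refine (norm_fundChain_le _ (R := C * (1 + r)) (fun w hw => ?_) ht.1).trans ?_
  · have := h (-Complex.I * w) ζ (by
      rw [symbolValue_eq_eval_monicPoly, ← hw]
      congr 1
      linear_combination -w * Complex.I_mul_I)
    simp only [Real.rpow_one, Complex.mul_im, Complex.neg_re, Complex.I_re, Complex.neg_im,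
      Complex.I_im] at this
    linarith
  · have ht0 := ht.1
    have htT : t ≤ T + 1 := by linarith [ht.2]
    rw [mul_assoc (_ ^ n), ← Real.exp_add]
    gcongr
    have h1 : C * t ≤ C * T := mul_le_mul_of_nonneg_left ht.2 hC.le
    have h2 : C * r * t ≤ C * r * (T + 1) := by gcongr
    nlinarith

lemma isFundamentalSymbol_forwardSolution {d : ℕ} (n : ℕ) (a : ℕ → MvPolynomial (Fin d) ℂ) :
    IsFundamentalSymbol (n + 1) a
      fun t ξ => forwardSolution (symbolCoeff n a fun j => ((ξ j : ℝ) : ℂ)) t where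
  eq_zero_of_neg t ht ξ := by simp [forwardSolution, ht]
  continuousOn ξ := by
    have h : Continuous (fundChain (symbolCoeff n a fun j => ((ξ j : ℝ) : ℂ)) 0) :=
      continuous_iff_continuousAt.2 fun t => (isDerivChain_fundChain _ 0 t).continuousAt
    exact h.continuousOn.congr fun t ht => by simp [forwardSolution, Set.indicator_of_mem ht]
  weak_eq ξ φ hφ hφc := by
    rw [← integral_forwardSolution (symbolCoeff n a fun j => ((ξ j : ℝ) : ℂ)) hφ hφc]
    simp only [polyPair_symbolCoeff]

lemma IsFundamentalSymbol.unique {d n : ℕ} {a : ℕ → MvPolynomial (Fin d) ℂ}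
    {σ₁ σ₂ : ℝ → Rd d → ℂ} (h₁ : IsFundamentalSymbol (n + 1) a σ₁)
    (h₂ : IsFundamentalSymbol (n + 1) a σ₂) : σ₁ = σ₂ := by
  have key : ∀ ξ, (fun t => σ₁ t ξ) = fun t => σ₂ t ξ := fun ξ => by
    refine eq_of_weak_eq (symbolCoeff n a fun j => ((ξ j : ℝ) : ℂ))
      (fun t ht => h₁.eq_zero_of_neg t ht ξ) (fun t ht => h₂.eq_zero_of_neg t ht ξ)
      (h₁.continuousOn ξ) (h₂.continuousOn ξ) fun φ hφ hφc => ?_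
    simp only [polyPair_symbolCoeff]
    rw [h₁.weak_eq ξ φ hφ hφc, h₂.weak_eq ξ φ hφ hφc]
  funext t ξ
  exact congrFun (key ξ) t

lemma IsFundamentalSymbol.eq_complexSymbol {d n : ℕ} {a : ℕ → MvPolynomial (Fin d) ℂ}
    {σ : ℝ → Rd d → ℂ} (h : IsFundamentalSymbol (n + 1) a σ) {t : ℝ} (ht : 0 ≤ t) (ξ : Rd d) :
    σ t ξ = complexSymbol n a t fun j => ((ξ j : ℝ) : ℂ) := by
  rw [h.unique (isFundamentalSymbol_forwardSolution n a)]
  simp [forwardSolution, complexSymbol, ht]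

/-! ### Holomorphic parametric integrals and shifts of contour -/

lemma differentiable_integral_of_dominated {X : Type*} [MeasurableSpace X]
    {μ : MeasureTheory.Measure X} {F : X → ℂ → ℂ}
    (hm : ∀ z, MeasureTheory.AEStronglyMeasurable (fun x => F x z) μ)
    (hd : ∀ x, Differentiable ℂ (F x))
    (hb : ∀ R : ℝ, ∃ b : X → ℝ, MeasureTheory.Integrable b μ ∧ ∀ x z, ‖z‖ ≤ R → ‖F x z‖ ≤ b x) :
    Differentiable ℂ fun z => ∫ x, F x z ∂μ := by
  intro z₀
  obtain ⟨b, hbi, hb⟩ := hb (‖z₀‖ + 2)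
  have hderiv_meas : MeasureTheory.AEStronglyMeasurable (fun x => deriv (F x) z₀) μ := by
    have hlim : ∀ x, Filter.Tendsto
        (fun k : ℕ => ((1 : ℂ) / (k + 1))⁻¹ • (F x (z₀ + 1 / (k + 1)) - F x z₀))
        Filter.atTop (nhds (deriv (F x) z₀)) := by
      intro x
      have h1 : Filter.Tendsto (fun k : ℕ => (1 : ℂ) / (k + 1)) Filter.atTop
          (nhdsWithin 0 {0}ᶜ) := by
        refine tendsto_nhdsWithin_iff.2 ⟨tendsto_one_div_add_atTop_nhds_zero_nat, ?_⟩
        refine Filter.Eventually.of_forall fun k => ?_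
        have : (k : ℂ) + 1 ≠ 0 := Nat.cast_add_one_ne_zero k
        simpa using this
      exact ((hd x z₀).hasDerivAt.tendsto_slope_zero).comp h1
    refine aestronglyMeasurable_of_tendsto_ae Filter.atTop (fun k => ?_)
      (Filter.Eventually.of_forall hlim)
    exact ((hm (z₀ + 1 / (k + 1))).sub (hm z₀)).const_smul (((1 : ℂ) / (k + 1))⁻¹)
  refine (hasDerivAt_integral_of_dominated_loc_of_deriv_le (F := fun z x => F x z)
    (F' := fun z x => deriv (F x) z) (bound := b) (Metric.ball_mem_nhds z₀ one_pos)
    (Filter.Eventually.of_forall hm) ?_ hderiv_meas ?_ hbi ?_).2.differentiableAt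
  · exact hbi.mono' (hm z₀) (Filter.Eventually.of_forall fun x => hb x z₀ (by linarith))
  · refine Filter.Eventually.of_forall fun x z hz => ?_
    have := Complex.norm_deriv_le_of_forall_mem_sphere_norm_le (c := z) (f := F x) (C := b x)
      one_pos (hd x).diffContOnCl (fun w hw => hb x w ?_)
    · simpa using this
    · have h1 : ‖w - z‖ = 1 := by simpa using hw
      have h2 : ‖z - z₀‖ < 1 := by simpa [dist_eq_norm] using hz
      calc ‖w‖ = ‖(w - z) + (z - z₀) + z₀‖ := by ring_nf
        _ ≤ ‖w - z‖ + ‖z - z₀‖ + ‖z₀‖ := norm_add₃_le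
        _ ≤ ‖z₀‖ + 2 := by linarith
  · exact Filter.Eventually.of_forall fun x z _ => (hd x z).hasDerivAt

lemma integral_eq_of_translation_invariant {X : Type*} [MeasurableSpace X]
    {μ : MeasureTheory.Measure X} {F : X → ℂ → ℂ}
    (hm : ∀ z, MeasureTheory.AEStronglyMeasurable (fun x => F x z) μ)
    (hd : ∀ x, Differentiable ℂ (F x))
    (hb : ∀ R : ℝ, ∃ b : X → ℝ, MeasureTheory.Integrable b μ ∧ ∀ x z, ‖z‖ ≤ R → ‖F x z‖ ≤ b x)
    (hinv : ∀ s ∈ Set.Ioo (0 : ℝ) 1, ∫ x, F x s ∂μ = ∫ x, F x 0 ∂μ) (z : ℂ) :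
    ∫ x, F x z ∂μ = ∫ x, F x 0 ∂μ := by
  have hdiff := differentiable_integral_of_dominated hm hd hb
  have h1 : AnalyticOnNhd ℂ (fun z => ∫ x, F x z ∂μ) Set.univ := fun z _ =>
    hdiff.analyticAt z
  have h2 : AnalyticOnNhd ℂ (fun _ : ℂ => ∫ x, F x 0 ∂μ) Set.univ := analyticOnNhd_const
  refine congrFun (h1.eq_of_frequently_eq h2 (z₀ := 0) ?_) z
  have htend : Filter.Tendsto (fun k : ℕ => (((1 : ℝ) / ((k + 1 : ℕ) + 1) : ℝ) : ℂ)) Filter.atTop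
      (nhdsWithin 0 {0}ᶜ) := by
    refine tendsto_nhdsWithin_iff.2 ⟨?_, Filter.Eventually.of_forall fun k => ?_⟩
    · have := (tendsto_one_div_add_atTop_nhds_zero_nat (𝕜 := ℝ)).comp (Filter.tendsto_add_atTop_nat 1)
      simpa [Function.comp_def] using (Complex.continuous_ofReal.tendsto 0).comp this
    · have : (1 : ℝ) / ((k + 1 : ℕ) + 1) ≠ 0 := by positivity
      exact Complex.ofReal_ne_zero.2 this
  refine htend.frequently (Filter.Frequently.of_forall fun k => hinv _ ⟨by positivity, ?_⟩)
  rw [div_lt_one (by positivity)]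
  push_cast
  have : (0 : ℝ) ≤ k := Nat.cast_nonneg k
  linarith

/-! ### Gaussian bounds from coordinatewise bounds -/

lemma le_mul_exp_neg_norm_sq {d : ℕ} {D M c : ℝ} (hM : 0 ≤ M) (hc : 0 ≤ c) (v : Rd d)
    (h0 : D ≤ M) (h : ∀ j, D ≤ M * Real.exp (-c * v j ^ 2)) :
    D ≤ M * Real.exp (-(c / (d + 1)) * ‖v‖ ^ 2) := by
  have hnorm : ‖v‖ ^ 2 = ∑ j, v j ^ 2 := by
    rw [EuclideanSpace.norm_sq_eq]; simp
  by_cases hv : ∃ j, ‖v‖ ^ 2 ≤ (d + 1) * v j ^ 2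
  · obtain ⟨j, hj⟩ := hv
    refine (h j).trans ?_
    refine mul_le_mul_of_nonneg_left (Real.exp_le_exp.2 ?_) hM
    rw [neg_mul, neg_mul, neg_le_neg_iff, div_mul_eq_mul_div, div_le_iff₀ (by positivity)]
    nlinarith
  · push Not at hv
    have h1 : ∑ j : Fin d, (d + 1) * v j ^ 2 ≤ ∑ _j : Fin d, ‖v‖ ^ 2 :=
      Finset.sum_le_sum fun j _ => (hv j).le
    rw [← Finset.mul_sum, ← hnorm] at h1
    simp only [Finset.sum_const, Finset.card_univ, Fintype.card_fin, nsmul_eq_mul] at h1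
    have h2 : ‖v‖ ^ 2 = 0 := le_antisymm (by linarith) (sq_nonneg _)
    simpa [h2] using h0

lemma factorial_two_mul_le (l : ℕ) : (2 * l).factorial ≤ (2 ^ l * l.factorial) ^ 2 := by
  induction l with
  | zero => simp
  | succ l ih =>
    rw [show 2 * (l + 1) = 2 * l + 1 + 1 by ring, Nat.factorial_succ, Nat.factorial_succ,
      Nat.factorial_succ]
    calc (2 * l + 1 + 1) * ((2 * l + 1) * (2 * l).factorial)
        ≤ (2 * l + 1 + 1) * ((2 * l + 1 + 1) * (2 ^ l * l.factorial) ^ 2) := by gcongr; omega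
      _ = _ := by ring

lemma le_mul_exp_of_forall_pow_le {x D M A : ℝ} (hA : 0 < A) (hM : 0 ≤ M)
    (h : ∀ k : ℕ, |x| ^ k * D ≤ M * A ^ k * √(k.factorial)) :
    D ≤ 2 * M * Real.exp (-(1 / (4 * A ^ 2)) * x ^ 2) := by
  set δ := 1 / (4 * A ^ 2) with hδ
  have hterm : ∀ l : ℕ, (δ * x ^ 2) ^ l / l.factorial * D ≤ M * (1 / 2) ^ l := by
    intro l
    have h1 := h (2 * l)
    have h2 : √((2 * l).factorial : ℝ) ≤ 2 ^ l * l.factorial := by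
      refine Real.sqrt_le_iff.2 ⟨by positivity, ?_⟩
      exact_mod_cast factorial_two_mul_le l
    rw [pow_mul, sq_abs] at h1
    have h3 : (x ^ 2) ^ l * D ≤ M * A ^ (2 * l) * (2 ^ l * l.factorial) :=
      h1.trans (by gcongr)
    have hl : (0 : ℝ) < l.factorial := by positivity
    calc (δ * x ^ 2) ^ l / l.factorial * D = δ ^ l / l.factorial * ((x ^ 2) ^ l * D) := by
          rw [mul_pow]; ring
      _ ≤ δ ^ l / l.factorial * (M * A ^ (2 * l) * (2 ^ l * l.factorial)) := by
          gcongr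
      _ = M * (δ * A ^ 2 * 2) ^ l := by
          rw [mul_pow, mul_pow, pow_mul]; field_simp
      _ = _ := by
          congr 2
          rw [hδ]; field_simp; norm_num
  have hsum1 : HasSum (fun l : ℕ => (δ * x ^ 2) ^ l / l.factorial * D)
      (Real.exp (δ * x ^ 2) * D) := by
    rw [Real.exp_eq_exp_ℝ]
    exact (NormedSpace.expSeries_div_hasSum_exp (δ * x ^ 2)).mul_right D
  have hsum2 : HasSum (fun l : ℕ => M * (1 / 2 : ℝ) ^ l) (M * 2) := hasSum_geometric_two.mul_left M
  have hle := hasSum_le hterm hsum1 hsum2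
  rw [neg_mul, Real.exp_neg, ← div_eq_mul_inv, le_div_iff₀ (Real.exp_pos _)]
  linarith

/-! ### Coordinate derivatives of Gelfand-Shilov functions -/

/-- The iterated partial derivative `∂_j^n f`. -/
noncomputable def coordDeriv {d : ℕ} (j : Fin d) (n : ℕ) (f : 𝓢(Rd d, ℂ)) : 𝓢(Rd d, ℂ) :=
  (fun u : 𝓢(Rd d, ℂ) => LineDeriv.lineDerivOp (EuclideanSpace.single j (1 : ℝ)) u)^[n] f

lemma List.foldr_iterate_single {α : Type*} {d : ℕ} (D : Fin d → α → α) (j : Fin d) (n : ℕ)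
    (f : α) (l : List (Fin d)) (hl : l.Nodup) :
    l.foldr (fun i h => (D i)^[(Pi.single j n : Fin d → ℕ) i] h) f =
      if j ∈ l then (D j)^[n] f else f := by
  induction l with
  | nil => simp
  | cons i l ih =>
    rw [List.nodup_cons] at hl
    rw [List.foldr_cons, ih hl.2]
    by_cases hij : i = j
    · subst hij
      simp [hl.1]
    · simp [hij, Ne.symm hij]

lemma multiDeriv_single {d : ℕ} (j : Fin d) (n : ℕ) (f : 𝓢(Rd d, ℂ)) :
    multiDeriv (Pi.single j n) f = coordDeriv j n f := by
  unfold multiDeriv coordDeriv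
  rw [List.foldr_iterate_single (fun i u =>
    LineDeriv.lineDerivOp (EuclideanSpace.single i (1 : ℝ)) u) j n f _ (List.nodup_finRange d)]
  simp

lemma multiFactorial_single {d : ℕ} (j : Fin d) (n : ℕ) :
    multiFactorial (Pi.single j n) = n.factorial := by
  unfold multiFactorial
  rw [Finset.prod_eq_single j]
  · simp
  · intro i _ hi; simp [hi]
  · simp

lemma prod_pow_single {d : ℕ} (x : Fin d → ℝ) (j : Fin d) (n : ℕ) :
    ∏ i, x i ^ (Pi.single j n : Fin d → ℕ) i = x j ^ n := by
  rw [Finset.prod_eq_single j]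
  · simp
  · intro i _ hi; simp [hi]
  · simp

lemma IsGelfandShilov.norm_coordDeriv_le {d : ℕ} {g : 𝓢(Rd d, ℂ)}
    (hg : IsGelfandShilov (1 / 2) (1 / 2) g) :
    ∃ K B ε : ℝ, 0 < K ∧ 0 < B ∧ 0 < ε ∧ ∀ (j : Fin d) (n : ℕ) (x : Rd d),
      ‖coordDeriv j n g x‖ ≤ K * (B ^ n * √n.factorial) * Real.exp (-ε * ‖x‖ ^ 2) := by
  obtain ⟨A, B, K, hA, hB, h⟩ := hg
  refine ⟨2 * (|K| + 1), B, 1 / (4 * A ^ 2) / (d + 1), by positivity, hB, by positivity,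
    fun j n x => ?_⟩
  set M := (|K| + 1) * (B ^ n * √n.factorial) with hM
  have hM0 : 0 ≤ M := by positivity
  have key : ∀ (i : Fin d) (k : ℕ),
      |x i| ^ k * ‖coordDeriv j n g x‖ ≤ M * A ^ k * √(k.factorial) := by
    intro i k
    have := h (Pi.single i k) (Pi.single j n) x
    rw [multiDeriv_single, multiFactorial_single, multiFactorial_single, prod_pow_single,
      Finset.sum_pi_single', Finset.sum_pi_single', ← Real.sqrt_eq_rpow, ← Real.sqrt_eq_rpow]
      at this
    simp only [Finset.mem_univ, if_true, norm_mul, Complex.norm_real, norm_pow,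
      Real.norm_eq_abs] at this
    refine this.trans ?_
    have hK : K ≤ |K| + 1 := (le_abs_self K).trans (by linarith)
    calc K * A ^ k * B ^ n * √k.factorial * √n.factorial
        ≤ (|K| + 1) * A ^ k * B ^ n * √k.factorial * √n.factorial := by gcongr
      _ = _ := by rw [hM]; ring
  have h0 : ‖coordDeriv j n g x‖ ≤ M := by simpa using key j 0
  have := le_mul_exp_neg_norm_sq (D := ‖coordDeriv j n g x‖) (M := 2 * M)
    (c := 1 / (4 * A ^ 2)) (by positivity) (by positivity) x (by linarith)
    (fun i => le_mul_exp_of_forall_pow_le hA hM0 (key i))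
  rw [hM, ← mul_assoc] at this
  exact this

lemma IsGelfandShilov.norm_le {d : ℕ} {g : 𝓢(Rd d, ℂ)}
    (hg : IsGelfandShilov (1 / 2) (1 / 2) g) :
    ∃ K ε : ℝ, 0 < K ∧ 0 < ε ∧ ∀ x, ‖g x‖ ≤ K * Real.exp (-ε * ‖x‖ ^ 2) := by
  rcases Nat.eq_zero_or_pos d with rfl | hd
  · refine ⟨‖g 0‖ + 1, 1, by positivity, one_pos, fun x => ?_⟩
    rw [Subsingleton.elim x 0]
    simp
  · obtain ⟨K, B, ε, hK, hB, hε, h⟩ := hg.norm_coordDeriv_le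
    exact ⟨K, ε, hK, hε, fun x => by simpa [coordDeriv] using h ⟨0, hd⟩ 0 x⟩

lemma isDerivChain_coordDeriv {d : ℕ} (g : 𝓢(Rd d, ℂ)) (j : Fin d) (x : Rd d) :
    IsDerivChain fun n s => coordDeriv j n g (x + s • EuclideanSpace.single j (1 : ℝ)) := by
  intro n s
  have h1 : HasDerivAt (fun s : ℝ => x + s • EuclideanSpace.single j (1 : ℝ))
      (EuclideanSpace.single j (1 : ℝ) : Rd d) s := by
    simpa using ((hasDerivAt_id s).smul_const (EuclideanSpace.single j (1 : ℝ))).const_add x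
  have h2 := ((coordDeriv j n g).hasFDerivAt
    (x := x + s • EuclideanSpace.single j (1 : ℝ))).comp_hasDerivAt s h1
  rw [← SchwartzMap.lineDerivOp_apply_eq_fderiv] at h2
  simp only [coordDeriv, Function.iterate_succ_apply'] at h2 ⊢
  exact h2

/-! ### Entire extension in one coordinate -/

lemma IsDerivChain.norm_sub_taylor_le {n : ℕ} {y : ℕ → ℝ → ℂ} (hy : IsDerivChain y) {M : ℝ}
    (hM : ∀ s, ‖y n s‖ ≤ M) {s : ℝ} (hs : 0 ≤ s) :
    ‖y 0 s - ∑ k ∈ Finset.range n, y k 0 * (s : ℂ) ^ k / k.factorial‖ ≤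
      M * (s ^ n / n.factorial) := by
  induction n generalizing y s with
  | zero => simpa using hM s
  | succ n ih =>
    have hy' : IsDerivChain fun k => y (k + 1) := fun k => hy (k + 1)
    have hf : ∀ r : ℝ, HasDerivAt
        (fun r : ℝ => y 0 r - ∑ k ∈ Finset.range (n + 1), y k 0 * (r : ℂ) ^ k / k.factorial)
        (y 1 r - ∑ k ∈ Finset.range n, y (k + 1) 0 * (r : ℂ) ^ k / k.factorial) r := by
      intro r
      refine HasDerivAt.sub (hy 0 r) ?_
      have : ∀ k : ℕ, HasDerivAt (fun r : ℝ => y k 0 * (r : ℂ) ^ k / k.factorial)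
          (y k 0 * (k * (r : ℂ) ^ (k - 1)) / k.factorial) r := fun k =>
        (((hasDerivAt_pow k (r : ℂ)).comp_ofReal).const_mul (y k 0)).div_const _
      refine (HasDerivAt.fun_sum fun k (_ : k ∈ Finset.range (n + 1)) => this k).congr_deriv ?_
      rw [Finset.sum_range_succ']
      simp only [CharP.cast_eq_zero, zero_mul, mul_zero, zero_div, add_zero]
      refine Finset.sum_congr rfl fun k _ => ?_
      rw [Nat.factorial_succ, Nat.add_sub_cancel]
      have h1 : ((k + 1 : ℕ) : ℂ) ≠ 0 := Nat.cast_ne_zero.2 (by omega)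
      have h2 : (k.factorial : ℂ) ≠ 0 := Nat.cast_ne_zero.2 (Nat.factorial_ne_zero k)
      rw [Nat.cast_mul]
      field_simp
    have hB : ∀ r : ℝ, HasDerivAt (fun r : ℝ => M * (r ^ (n + 1) / (n + 1).factorial))
        (M * (r ^ n / n.factorial)) r := by
      intro r
      refine (((hasDerivAt_pow (n + 1) r).div_const _).const_mul M).congr_deriv ?_
      rw [Nat.factorial_succ, Nat.add_sub_cancel]
      have h1 : ((n + 1 : ℕ) : ℝ) ≠ 0 := Nat.cast_ne_zero.2 (by omega)
      rw [Nat.cast_mul]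
      field_simp
    refine image_norm_le_of_norm_deriv_right_le_deriv_boundary (a := 0) (b := s)
      (fun r _ => (hf r).continuousAt.continuousWithinAt)
      (fun r _ => (hf r).hasDerivWithinAt) ?_ hB (fun r hr => ih hy' hM hr.1)
      (Set.right_mem_Icc.2 hs)
    rw [Finset.sum_range_succ']
    simp

lemma pow_div_sqrt_factorial_le {b : ℝ} (hb : 0 ≤ b) (n : ℕ) :
    b ^ n / √n.factorial ≤ Real.exp (b ^ 2) * √(1 / 2) ^ n := by
  have h1 := Real.pow_div_factorial_le_exp (2 * b ^ 2) (by positivity) n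
  rw [← pow_le_pow_iff_left₀ (by positivity) (by positivity) two_ne_zero, div_pow, mul_pow,
    Real.sq_sqrt (by positivity), ← pow_mul, ← pow_mul, ← Real.exp_nat_mul, mul_comm n 2,
    pow_mul, pow_mul, Real.sq_sqrt (by positivity)]
  calc (b ^ 2) ^ n / n.factorial = (2 * b ^ 2) ^ n / n.factorial * (1 / 2) ^ n := by
        rw [mul_pow, one_div, inv_pow]; field_simp
    _ ≤ _ := by push_cast; gcongr

lemma sqrt_half_lt_one : √(1 / 2 : ℝ) < 1 := by
  rw [Real.sqrt_lt' one_pos]; norm_num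

lemma summable_pow_div_sqrt_factorial {b : ℝ} (hb : 0 ≤ b) :
    Summable fun n : ℕ => b ^ n / √n.factorial :=
  Summable.of_nonneg_of_le (fun n => by positivity) (pow_div_sqrt_factorial_le hb)
    ((summable_geometric_of_lt_one (Real.sqrt_nonneg _) sqrt_half_lt_one).mul_left _)

lemma tsum_pow_div_sqrt_factorial_le {b : ℝ} (hb : 0 ≤ b) :
    ∑' n : ℕ, b ^ n / √n.factorial ≤ (1 - √(1 / 2))⁻¹ * Real.exp (b ^ 2) := by
  refine (Summable.tsum_le_tsum (pow_div_sqrt_factorial_le hb)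
    (summable_pow_div_sqrt_factorial hb)
    ((summable_geometric_of_lt_one (Real.sqrt_nonneg _) sqrt_half_lt_one).mul_left _)).trans ?_
  rw [tsum_mul_left, tsum_geometric_of_lt_one (Real.sqrt_nonneg _) sqrt_half_lt_one, mul_comm]

/-- The Taylor series of `f` at `x` in the `j`-th coordinate, evaluated at a complex number. -/
noncomputable def coordExtension {d : ℕ} (j : Fin d) (f : 𝓢(Rd d, ℂ)) (x : Rd d) (z : ℂ) : ℂ :=
  ∑' n : ℕ, coordDeriv j n f x * z ^ n / n.factorial

section Extension

variable {d : ℕ} {g : 𝓢(Rd d, ℂ)} {j : Fin d} {K B ε : ℝ}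

lemma norm_coordExtension_term_le
    (h : ∀ (n : ℕ) (x : Rd d),
      ‖coordDeriv j n g x‖ ≤ K * (B ^ n * √n.factorial) * Real.exp (-ε * ‖x‖ ^ 2))
    (n : ℕ) (x : Rd d) (z : ℂ) :
    ‖coordDeriv j n g x * z ^ n / n.factorial‖ ≤
      K * Real.exp (-ε * ‖x‖ ^ 2) * ((B * ‖z‖) ^ n / √n.factorial) := by
  rw [norm_div, norm_mul, norm_pow, Complex.norm_natCast]
  have hn : (0 : ℝ) < n.factorial := by positivity
  have hsq : √(n.factorial : ℝ) * √(n.factorial : ℝ) = n.factorial :=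
    Real.mul_self_sqrt hn.le
  have hs : 0 < √(n.factorial : ℝ) := Real.sqrt_pos.2 hn
  calc ‖coordDeriv j n g x‖ * ‖z‖ ^ n / n.factorial
      ≤ K * (B ^ n * √n.factorial) * Real.exp (-ε * ‖x‖ ^ 2) * ‖z‖ ^ n / n.factorial := by
        gcongr; exact h n x
    _ = K * (B ^ n * √n.factorial) * Real.exp (-ε * ‖x‖ ^ 2) * ‖z‖ ^ n /
          (√n.factorial * √n.factorial) := by rw [hsq]
    _ = _ := by rw [mul_pow]; field_simp

lemma norm_coordExtension_le (hK : 0 ≤ K) (hB : 0 ≤ B)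
    (h : ∀ (n : ℕ) (x : Rd d),
      ‖coordDeriv j n g x‖ ≤ K * (B ^ n * √n.factorial) * Real.exp (-ε * ‖x‖ ^ 2))
    (x : Rd d) (z : ℂ) :
    ‖coordExtension j g x z‖ ≤
      K * (1 - √(1 / 2))⁻¹ * Real.exp (-ε * ‖x‖ ^ 2) * Real.exp (B ^ 2 * ‖z‖ ^ 2) := by
  have hb : 0 ≤ B * ‖z‖ := by positivity
  refine (tsum_of_norm_bounded ((summable_pow_div_sqrt_factorial hb).hasSum.mul_left _)
    (fun n => norm_coordExtension_term_le h n x z)).trans ?_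
  calc K * Real.exp (-ε * ‖x‖ ^ 2) * ∑' n : ℕ, (B * ‖z‖) ^ n / √n.factorial
      ≤ K * Real.exp (-ε * ‖x‖ ^ 2) * ((1 - √(1 / 2))⁻¹ * Real.exp ((B * ‖z‖) ^ 2)) := by
        gcongr
        exact tsum_pow_div_sqrt_factorial_le hb
    _ = _ := by rw [mul_pow]; ring

lemma differentiable_coordExtension (hK : 0 ≤ K) (hB : 0 ≤ B)
    (h : ∀ (n : ℕ) (x : Rd d),
      ‖coordDeriv j n g x‖ ≤ K * (B ^ n * √n.factorial) * Real.exp (-ε * ‖x‖ ^ 2))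
    (x : Rd d) : Differentiable ℂ (coordExtension j g x) := by
  intro z
  have hb : 0 ≤ B * (‖z‖ + 1) := by positivity
  refine (Complex.differentiableOn_tsum_of_summable_norm
    ((summable_pow_div_sqrt_factorial hb).mul_left (K * Real.exp (-ε * ‖x‖ ^ 2)))
    (fun n => ?_) Metric.isOpen_ball (fun n w hw =>
      (norm_coordExtension_term_le h n x w).trans ?_)).differentiableAt
    (Metric.isOpen_ball.mem_nhds (Metric.mem_ball_self (x := z) one_pos))
  · exact (((differentiable_id.pow n).const_mul _).div_const _).differentiableOn
  · have : ‖w‖ ≤ ‖z‖ + 1 := by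
      have h1 : ‖w - z‖ < 1 := by simpa [dist_eq_norm] using hw
      calc ‖w‖ = ‖(w - z) + z‖ := by ring_nf
        _ ≤ ‖w - z‖ + ‖z‖ := norm_add_le _ _
        _ ≤ _ := by linarith
    gcongr

lemma continuous_coordExtension (hK : 0 ≤ K) (hB : 0 ≤ B) (hε : 0 ≤ ε)
    (h : ∀ (n : ℕ) (x : Rd d),
      ‖coordDeriv j n g x‖ ≤ K * (B ^ n * √n.factorial) * Real.exp (-ε * ‖x‖ ^ 2))
    (z : ℂ) : Continuous fun x => coordExtension j g x z := by
  have hb : 0 ≤ B * ‖z‖ := by positivity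
  refine continuous_tsum (fun n => ?_) ((summable_pow_div_sqrt_factorial hb).mul_left K)
    (fun n x => (norm_coordExtension_term_le h n x z).trans ?_)
  · exact ((coordDeriv j n g).continuous.mul continuous_const).div_const _
  · have : Real.exp (-ε * ‖x‖ ^ 2) ≤ 1 := by
      rw [Real.exp_le_one_iff]
      have : 0 ≤ ε * ‖x‖ ^ 2 := by positivity
      linarith
    refine mul_le_mul_of_nonneg_right ?_ (by positivity)
    nlinarith

lemma coordExtension_ofReal (hK : 0 ≤ K) (hB : 0 ≤ B) (hε : 0 ≤ ε)
    (h : ∀ (n : ℕ) (x : Rd d),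
      ‖coordDeriv j n g x‖ ≤ K * (B ^ n * √n.factorial) * Real.exp (-ε * ‖x‖ ^ 2))
    (x : Rd d) {s : ℝ} (hs : 0 ≤ s) :
    coordExtension j g x s = g (x + s • EuclideanSpace.single j (1 : ℝ)) := by
  have hb : 0 ≤ B * s := by positivity
  have hsum : Summable fun n : ℕ => coordDeriv j n g x * (s : ℂ) ^ n / n.factorial := by
    refine Summable.of_norm_bounded ((summable_pow_div_sqrt_factorial hb).mul_left
      (K * Real.exp (-ε * ‖x‖ ^ 2))) fun n => ?_
    have := norm_coordExtension_term_le h n x s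
    rwa [Complex.norm_real, Real.norm_of_nonneg hs] at this
  refine tendsto_nhds_unique hsum.hasSum.tendsto_sum_nat ?_
  rw [tendsto_iff_norm_sub_tendsto_zero]
  have hM : ∀ n (r : ℝ), ‖coordDeriv j n g (x + r • EuclideanSpace.single j (1 : ℝ))‖ ≤
      K * (B ^ n * √n.factorial) := by
    intro n r
    refine (h n _).trans (mul_le_of_le_one_right (by positivity) ?_)
    rw [Real.exp_le_one_iff]
    have : 0 ≤ ε * ‖x + r • EuclideanSpace.single j (1 : ℝ)‖ ^ 2 := by positivity
    linarith
  refine squeeze_zero (fun n => norm_nonneg _) (fun n => ?_)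
    (by simpa using (summable_pow_div_sqrt_factorial hb).tendsto_atTop_zero.const_mul K)
  have := (isDerivChain_coordDeriv g j x).norm_sub_taylor_le (hM n) hs
  rw [norm_sub_rev]
  simp only [zero_smul, add_zero] at this
  refine this.trans (le_of_eq ?_)
  have hn : (0 : ℝ) < n.factorial := by positivity
  have hsq : √(n.factorial : ℝ) * √(n.factorial : ℝ) = n.factorial :=
    Real.mul_self_sqrt hn.le
  have hs : 0 < √(n.factorial : ℝ) := Real.sqrt_pos.2 hn
  rw [mul_pow]
  nth_rw 2 [← hsq]
  field_simp

end Extension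

/-! ### Entire extension of the Fourier transform in one coordinate -/

lemma integrable_exp_neg_mul_norm_sq {d : ℕ} {ε : ℝ} (hε : 0 < ε) :
    MeasureTheory.Integrable fun x : Rd d => Real.exp (-ε * ‖x‖ ^ 2) := by
  have := (GaussianFourier.integrable_cexp_neg_mul_sq_norm_add (V := Rd d) (b := (ε : ℂ))
    (by simpa using hε) 0 0).norm
  refine this.congr (Filter.Eventually.of_forall fun x => ?_)
  simp only [Complex.norm_exp, zero_mul, add_zero]
  congr 1
  rw [← Complex.ofReal_pow, ← Complex.ofReal_neg, ← Complex.ofReal_mul, Complex.ofReal_re]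

lemma abs_coord_le_norm {d : ℕ} (x : Rd d) (j : Fin d) : |x j| ≤ ‖x‖ := by
  simpa using PiLp.norm_apply_le x j

lemma exp_neg_mul_exp_coord_le {d : ℕ} {ε : ℝ} (hε : 0 < ε) (r : ℝ) (x : Rd d) (j : Fin d) :
    Real.exp (-ε * ‖x‖ ^ 2) * Real.exp (r * x j) ≤
      Real.exp (r ^ 2 / (2 * ε)) * Real.exp (-(ε / 2) * ‖x‖ ^ 2) := by
  rw [← Real.exp_add, ← Real.exp_add, Real.exp_le_exp]
  have h1 : r * x j ≤ |r| * ‖x‖ := by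
    refine (le_abs_self _).trans ?_
    rw [abs_mul]
    exact mul_le_mul_of_nonneg_left (abs_coord_le_norm x j) (abs_nonneg r)
  have h2 : |r| * ‖x‖ ≤ r ^ 2 / (2 * ε) + ε / 2 * ‖x‖ ^ 2 := by
    rw [← sq_abs r, div_add' _ _ _ (by positivity), le_div_iff₀ (by positivity)]
    nlinarith [sq_nonneg (|r| - ε * ‖x‖)]
  linarith

lemma inner_single_right {d : ℕ} (x : Rd d) (j : Fin d) (s : ℝ) :
    inner ℝ x (s • EuclideanSpace.single j (1 : ℝ)) = s * x j := by
  rw [inner_smul_right, EuclideanSpace.inner_single_right]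
  simp

lemma inner_single_left {d : ℕ} (x : Rd d) (j : Fin d) (s : ℝ) :
    inner ℝ (s • EuclideanSpace.single j (1 : ℝ)) x = s * x j := by
  rw [real_inner_comm, inner_single_right]

/-- The Fourier transform `ĝ(ξ + z e_j)` at a point with one complex coordinate. -/
noncomputable def fourierExt {d : ℕ} (j : Fin d) (g : Rd d → ℂ) (ξ : Rd d) (z : ℂ) : ℂ :=
  ∫ x, g x * Complex.exp (-2 * Real.pi * Complex.I * (((inner ℝ x ξ : ℝ) : ℂ) + z * x j))

lemma fourierExt_add_ofReal {d : ℕ} (j : Fin d) (g : Rd d → ℂ) (ξ : Rd d) (z : ℂ) (s : ℝ) :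
    fourierExt j g ξ (z + s) = fourierExt j g (ξ + s • EuclideanSpace.single j (1 : ℝ)) z := by
  unfold fourierExt
  refine MeasureTheory.integral_congr_ae (Filter.Eventually.of_forall fun x => ?_)
  simp only [inner_add_right, inner_single_right]
  push_cast
  ring_nf

lemma fourierExt_zero {d : ℕ} (j : Fin d) (g : Rd d → ℂ) (ξ : Rd d) :
    fourierExt j g ξ 0 = 𝓕 g ξ := by
  rw [Real.fourier_eq']
  unfold fourierExt
  refine MeasureTheory.integral_congr_ae (Filter.Eventually.of_forall fun x => ?_)
  simp only [smul_eq_mul, zero_mul, add_zero]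
  push_cast
  ring_nf

lemma stronglyMeasurable_fourierExt {d : ℕ} (j : Fin d) {g : Rd d → ℂ} (hg : Continuous g)
    (z : ℂ) : MeasureTheory.StronglyMeasurable fun ξ => fourierExt j g ξ z := by
  unfold fourierExt
  refine MeasureTheory.StronglyMeasurable.integral_prod_right (Continuous.stronglyMeasurable ?_)
  simp only [Function.uncurry_def]
  fun_prop

lemma norm_exp_fourierExt {d : ℕ} (x ξ : Rd d) (j : Fin d) (z : ℂ) :
    ‖Complex.exp (-2 * Real.pi * Complex.I * (((inner ℝ x ξ : ℝ) : ℂ) + z * x j))‖ =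
      Real.exp (2 * Real.pi * z.im * x j) := by
  rw [Complex.norm_exp]
  congr 1
  simp [Complex.mul_re, Complex.mul_im]
  ring

section FourierExt

variable {d : ℕ} {g : 𝓢(Rd d, ℂ)} {K B ε : ℝ}

lemma differentiable_fourierExt (j : Fin d) (hε : 0 < ε) (hK : 0 ≤ K)
    (hg : ∀ x, ‖g x‖ ≤ K * Real.exp (-ε * ‖x‖ ^ 2)) (ξ : Rd d) :
    Differentiable ℂ (fourierExt j g ξ) := by
  refine differentiable_integral_of_dominated (fun z => ?_) (fun x => ?_) (fun R => ?_)
  · refine Continuous.aestronglyMeasurable ?_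
    have := g.continuous
    fun_prop
  · fun_prop
  · refine ⟨fun x => K * (Real.exp ((2 * Real.pi * R) ^ 2 / (2 * ε)) *
      Real.exp (-(ε / 2) * ‖x‖ ^ 2)), ((integrable_exp_neg_mul_norm_sq (by positivity)).const_mul
        _).const_mul _, fun x z hz => ?_⟩
    rw [norm_mul, norm_exp_fourierExt]
    have hR : |z.im| ≤ R := (Complex.abs_im_le_norm z).trans hz
    calc ‖g x‖ * Real.exp (2 * Real.pi * z.im * x j)
        ≤ K * Real.exp (-ε * ‖x‖ ^ 2) * Real.exp (2 * Real.pi * z.im * x j) := by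
          gcongr; exact hg x
      _ = K * (Real.exp (-ε * ‖x‖ ^ 2) * Real.exp (2 * Real.pi * z.im * x j)) := by ring
      _ ≤ K * (Real.exp ((2 * Real.pi * z.im) ^ 2 / (2 * ε)) *
            Real.exp (-(ε / 2) * ‖x‖ ^ 2)) := by
          exact mul_le_mul_of_nonneg_left (exp_neg_mul_exp_coord_le hε _ x j) hK
      _ ≤ _ := by
          have h1 : (2 * Real.pi * z.im) ^ 2 ≤ (2 * Real.pi * R) ^ 2 := by
            rw [mul_pow, mul_pow _ R]
            exact mul_le_mul_of_nonneg_left (sq_le_sq' (by linarith [neg_abs_le z.im])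
              ((le_abs_self _).trans hR)) (by positivity)
          refine mul_le_mul_of_nonneg_left (mul_le_mul_of_nonneg_right
            (Real.exp_le_exp.2 ?_) (Real.exp_pos _).le) hK
          gcongr

lemma norm_fourierExt_shift_le (hK : 0 ≤ K) (hB : 0 ≤ B) (hε : 0 < ε) (j k : Fin d)
    (h : ∀ (n : ℕ) (x : Rd d),
      ‖coordDeriv k n g x‖ ≤ K * (B ^ n * √n.factorial) * Real.exp (-ε * ‖x‖ ^ 2))
    (ξ : Rd d) (τ κ : ℝ) :
    ‖fourierExt j g ξ (τ * Complex.I)‖ ≤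
      K * (1 - √(1 / 2))⁻¹ * (∫ x : Rd d, Real.exp (-(ε / 2) * ‖x‖ ^ 2)) *
        Real.exp ((2 * Real.pi * τ) ^ 2 / (2 * ε)) *
        Real.exp ((B ^ 2 * κ ^ 2 - 2 * Real.pi * κ) * ξ k ^ 2) := by
  set K' := K * (1 - √(1 / 2))⁻¹ with hK'
  have hK'0 : 0 ≤ K' :=
    mul_nonneg hK (inv_nonneg.2 (sub_nonneg.2 sqrt_half_lt_one.le))
  set δ : ℝ := if k = j then 1 else 0 with hδ
  have hδ1 : |δ| ≤ 1 := by rw [hδ]; split_ifs <;> simp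
  set F : Rd d → ℂ → ℂ := fun x μ => coordExtension k g x μ *
    Complex.exp (-2 * Real.pi * Complex.I * (((inner ℝ x ξ : ℝ) : ℂ) + μ * ξ k +
      τ * Complex.I * (x j + μ * δ))) with hF
  have hFnorm : ∀ x μ, ‖F x μ‖ ≤ K' * Real.exp (B ^ 2 * ‖μ‖ ^ 2) *
      Real.exp (2 * Real.pi * μ.im * ξ k + 2 * Real.pi * τ * (μ.re * δ)) *
      (Real.exp ((2 * Real.pi * τ) ^ 2 / (2 * ε)) * Real.exp (-(ε / 2) * ‖x‖ ^ 2)) := by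
    intro x μ
    have hexp : ‖Complex.exp (-2 * Real.pi * Complex.I * (((inner ℝ x ξ : ℝ) : ℂ) + μ * ξ k +
        τ * Complex.I * (x j + μ * δ)))‖ =
        Real.exp (2 * Real.pi * μ.im * ξ k + 2 * Real.pi * τ * (μ.re * δ)) *
          Real.exp (2 * Real.pi * τ * x j) := by
      rw [Complex.norm_exp, ← Real.exp_add]
      congr 1
      simp [Complex.mul_re, Complex.mul_im]
      ring
    simp only [hF]
    rw [norm_mul, hexp]
    have h1 := norm_coordExtension_le hK hB h x μ
    have h2 := exp_neg_mul_exp_coord_le hε (2 * Real.pi * τ) x j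
    calc _ ≤ K' * Real.exp (-ε * ‖x‖ ^ 2) * Real.exp (B ^ 2 * ‖μ‖ ^ 2) *
          (Real.exp (2 * Real.pi * μ.im * ξ k + 2 * Real.pi * τ * (μ.re * δ)) *
          Real.exp (2 * Real.pi * τ * x j)) := by gcongr
      _ = K' * Real.exp (B ^ 2 * ‖μ‖ ^ 2) *
          Real.exp (2 * Real.pi * μ.im * ξ k + 2 * Real.pi * τ * (μ.re * δ)) *
          (Real.exp (-ε * ‖x‖ ^ 2) * Real.exp (2 * Real.pi * τ * x j)) := by ring
      _ ≤ _ := by gcongr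
  have hgauss : MeasureTheory.Integrable fun x : Rd d => Real.exp (-(ε / 2) * ‖x‖ ^ 2) :=
    integrable_exp_neg_mul_norm_sq (by positivity)
  have hreal : ∀ s : ℝ, 0 ≤ s → ∫ x, F x s = fourierExt j g ξ (τ * Complex.I) := by
    intro s hs
    unfold fourierExt
    rw [← MeasureTheory.integral_add_right_eq_self
      (μ := (MeasureTheory.volume : MeasureTheory.Measure (Rd d)))
      (fun x => g x * Complex.exp (-2 * Real.pi * Complex.I *
        (((inner ℝ x ξ : ℝ) : ℂ) + τ * Complex.I * x j))) (s • EuclideanSpace.single k (1 : ℝ))]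
    refine MeasureTheory.integral_congr_ae (Filter.Eventually.of_forall fun x => ?_)
    simp only [hF]
    rw [coordExtension_ofReal hK hB hε.le h x hs, inner_add_left, inner_single_left]
    congr 3
    have : (x + s • EuclideanSpace.single k (1 : ℝ)) j = x j + s * δ := by
      simp [hδ, eq_comm]
    rw [this]
    push_cast
    ring
  have hshift := integral_eq_of_translation_invariant (μ := MeasureTheory.volume) (F := F)
    (fun μ => ?_) (fun x => ?_) (fun R => ?_)
    (fun s hs => by
      rw [hreal s hs.1.le]; simpa using (hreal 0 le_rfl).symm) (-(κ * ξ k : ℝ) * Complex.I)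
  · have h0 : ∫ x, F x 0 = fourierExt j g ξ (τ * Complex.I) := by simpa using hreal 0 le_rfl
    rw [← h0, ← hshift]
    refine (MeasureTheory.norm_integral_le_of_norm_le (((hgauss.const_mul _).const_mul _))
      (Filter.Eventually.of_forall fun x => hFnorm x _)).trans (le_of_eq ?_)
    rw [MeasureTheory.integral_const_mul, MeasureTheory.integral_const_mul]
    have hμ : ‖(-(κ * ξ k : ℝ) * Complex.I : ℂ)‖ ^ 2 = κ ^ 2 * ξ k ^ 2 := by
      rw [norm_mul, Complex.norm_I, mul_one, norm_neg, Complex.norm_real, Real.norm_eq_abs,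
        sq_abs, mul_pow]
    have him : (-(κ * ξ k : ℝ) * Complex.I : ℂ).im = -(κ * ξ k) := by simp
    have hre : (-(κ * ξ k : ℝ) * Complex.I : ℂ).re = 0 := by simp
    rw [hμ, him, hre]
    have : Real.exp ((B ^ 2 * κ ^ 2 - 2 * Real.pi * κ) * ξ k ^ 2) =
        Real.exp (B ^ 2 * (κ ^ 2 * ξ k ^ 2)) *
          Real.exp (2 * Real.pi * -(κ * ξ k) * ξ k + 2 * Real.pi * τ * (0 * δ)) := by
      rw [← Real.exp_add]; ring_nf
    rw [this]
    ring
  · refine Continuous.aestronglyMeasurable ?_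
    have := continuous_coordExtension hK hB hε.le h μ
    simp only [hF]
    fun_prop
  · have := differentiable_coordExtension hK hB h x
    simp only [hF]
    fun_prop
  · refine ⟨_, (((hgauss.const_mul (Real.exp ((2 * Real.pi * τ) ^ 2 / (2 * ε)))).const_mul
      (K' * Real.exp (B ^ 2 * R ^ 2) *
        Real.exp (2 * Real.pi * R * |ξ k| + 2 * Real.pi * |τ| * R)))), fun x μ hμ => ?_⟩
    refine (hFnorm x μ).trans ?_
    have hR : 0 ≤ R := (norm_nonneg μ).trans hμ
    have h1 : μ.im * ξ k ≤ R * |ξ k| := by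
      refine (le_abs_self _).trans ?_
      rw [abs_mul]
      exact mul_le_mul_of_nonneg_right ((Complex.abs_im_le_norm μ).trans hμ) (abs_nonneg _)
    have h2 : τ * (μ.re * δ) ≤ |τ| * R := by
      refine (le_abs_self _).trans ?_
      rw [abs_mul, abs_mul]
      refine mul_le_mul_of_nonneg_left ?_ (abs_nonneg _)
      calc |μ.re| * |δ| ≤ R * 1 :=
            mul_le_mul ((Complex.abs_re_le_norm μ).trans hμ) hδ1 (abs_nonneg _) hR
        _ = R := mul_one R
    have hpi := Real.pi_pos
    gcongr ?_ * Real.exp (_ * ?_ ^ 2) * Real.exp ?_ * _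
    · nlinarith

end FourierExt

lemma IsGelfandShilov.norm_fourierExt_le {d : ℕ} {g : 𝓢(Rd d, ℂ)}
    (hg : IsGelfandShilov (1 / 2) (1 / 2) g) :
    ∃ C c ε : ℝ, 0 < C ∧ 0 < c ∧ 0 < ε ∧ ∀ (j : Fin d) (ξ : Rd d) (z : ℂ),
      ‖fourierExt j g ξ z‖ ≤ C * Real.exp (c * z.im ^ 2) *
        Real.exp (-ε * ‖ξ + z.re • EuclideanSpace.single j (1 : ℝ)‖ ^ 2) := by
  obtain ⟨K, B, ε, hK, hB, hε, h⟩ := hg.norm_coordDeriv_le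
  have hs : 0 < (1 - √(1 / 2 : ℝ))⁻¹ := inv_pos.2 (sub_pos.2 sqrt_half_lt_one)
  set I := ∫ x : Rd d, Real.exp (-(ε / 2) * ‖x‖ ^ 2) with hI
  have hI0 : 0 ≤ I := MeasureTheory.integral_nonneg fun x => (Real.exp_pos _).le
  refine ⟨K * (1 - √(1 / 2))⁻¹ * (I + 1), (2 * Real.pi) ^ 2 / (2 * ε),
    Real.pi ^ 2 / B ^ 2 / (d + 1), by positivity, by positivity, by positivity, fun j ξ z => ?_⟩
  have hz : fourierExt j g ξ z =
      fourierExt j g (ξ + z.re • EuclideanSpace.single j (1 : ℝ)) (z.im * Complex.I) := by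
    rw [← fourierExt_add_ofReal, add_comm, Complex.re_add_im]
  rw [hz]
  set η := ξ + z.re • EuclideanSpace.single j (1 : ℝ)
  have hM : K * (1 - √(1 / 2))⁻¹ * I * Real.exp ((2 * Real.pi * z.im) ^ 2 / (2 * ε)) ≤
      K * (1 - √(1 / 2))⁻¹ * (I + 1) * Real.exp ((2 * Real.pi) ^ 2 / (2 * ε) * z.im ^ 2) := by
    rw [show (2 * Real.pi * z.im) ^ 2 / (2 * ε) = (2 * Real.pi) ^ 2 / (2 * ε) * z.im ^ 2 by ring]
    gcongr
    linarith
  refine le_mul_exp_neg_norm_sq (by positivity) (by positivity) η ?_ fun k => ?_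
  · have := norm_fourierExt_shift_le hK.le hB.le hε j j (h j) η z.im 0
    refine this.trans (le_trans (le_of_eq ?_) hM)
    simp [hI]
  · have := norm_fourierExt_shift_le hK.le hB.le hε j k (h k) η z.im (Real.pi / B ^ 2)
    refine this.trans ?_
    have e : B ^ 2 * (Real.pi / B ^ 2) ^ 2 - 2 * Real.pi * (Real.pi / B ^ 2) =
        -(Real.pi ^ 2 / B ^ 2) := by field_simp; ring
    rw [e]
    gcongr

lemma IsGelfandShilov.norm_fourier_le {d : ℕ} {g : 𝓢(Rd d, ℂ)}
    (hg : IsGelfandShilov (1 / 2) (1 / 2) g) :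
    ∃ C ε : ℝ, 0 < C ∧ 0 < ε ∧ ∀ ξ, ‖𝓕 (g : Rd d → ℂ) ξ‖ ≤ C * Real.exp (-ε * ‖ξ‖ ^ 2) := by
  rcases Nat.eq_zero_or_pos d with rfl | hd
  · refine ⟨‖𝓕 (g : Rd 0 → ℂ) 0‖ + 1, 1, by positivity, one_pos, fun x => ?_⟩
    rw [Subsingleton.elim x 0]
    simp
  · obtain ⟨C, c, ε, hC, hc, hε, h⟩ := hg.norm_fourierExt_le
    refine ⟨C, ε, hC, hε, fun ξ => ?_⟩
    have := h ⟨0, hd⟩ ξ 0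
    rw [fourierExt_zero] at this
    simpa using this

/-! ### Time-frequency shifts and the Gabor matrix on the Fourier side -/

lemma fourier_tfShift {d : ℕ} (z : TFPlane d) (g : Rd d → ℂ) (ξ : Rd d) :
    𝓕 (tfShift z g) ξ =
      Complex.exp (-2 * Real.pi * Complex.I * ((inner ℝ z.fst (ξ - z.snd) : ℝ) : ℂ)) *
        𝓕 g (ξ - z.snd) := by
  rw [Real.fourier_eq', Real.fourier_eq', ← MeasureTheory.integral_const_mul,
    ← MeasureTheory.integral_add_right_eq_self
      (μ := (MeasureTheory.volume : MeasureTheory.Measure (Rd d))) _ z.fst]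
  refine MeasureTheory.integral_congr_ae (Filter.Eventually.of_forall fun x => ?_)
  simp only [tfShift, smul_eq_mul, add_sub_cancel_right]
  rw [← mul_assoc, ← mul_assoc, ← Complex.exp_add, ← Complex.exp_add]
  congr 2
  simp only [inner_add_left, inner_sub_right, inner_add_right, real_inner_comm z.snd]
  push_cast
  ring

lemma norm_exp_two_pi_I_mul (r : ℝ) :
    ‖Complex.exp (2 * Real.pi * Complex.I * (r : ℂ))‖ = 1 := by
  rw [Complex.norm_exp]
  simp

lemma norm_exp_neg_two_pi_I_mul (r : ℝ) :
    ‖Complex.exp (-2 * Real.pi * Complex.I * (r : ℂ))‖ = 1 := by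
  rw [Complex.norm_exp]
  simp

lemma norm_fourier_tfShift {d : ℕ} (z : TFPlane d) (g : Rd d → ℂ) (ξ : Rd d) :
    ‖𝓕 (tfShift z g) ξ‖ = ‖𝓕 g (ξ - z.snd)‖ := by
  rw [fourier_tfShift, norm_mul, norm_exp_neg_two_pi_I_mul, one_mul]

lemma integrable_tfShift {d : ℕ} (z : TFPlane d) (g : 𝓢(Rd d, ℂ)) :
    MeasureTheory.Integrable (tfShift z g) := by
  refine (g.integrable.comp_sub_right z.fst).mono (Continuous.aestronglyMeasurable ?_)
    (Filter.Eventually.of_forall fun y => ?_)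
  · have := g.continuous
    unfold tfShift
    fun_prop
  · simp only [tfShift]
    rw [norm_mul, norm_exp_two_pi_I_mul, one_mul]

lemma integral_fourierInv_mul_conj {d : ℕ} {φ h : Rd d → ℂ} (hφ : MeasureTheory.Integrable φ)
    (hh : MeasureTheory.Integrable h) :
    ∫ y, 𝓕⁻ φ y * (starRingEnd ℂ) (h y) = ∫ ξ, φ ξ * (starRingEnd ℂ) (𝓕 h ξ) := by
  have hconj : MeasureTheory.Integrable fun y => (starRingEnd ℂ) (h y) :=
    (LinearIsometryEquiv.integrable_comp_iff (Complex.conjLIE)).2 hh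
  have key := VectorFourier.integral_fourierIntegral_smul_eq_flip (L := -innerₗ (Rd d))
    (μ := MeasureTheory.volume) (ν := MeasureTheory.volume)
    Real.continuous_fourierChar (by
      simp only [LinearMap.neg_apply, innerₗ_apply_apply]
      fun_prop) hφ hconj
  simp only [smul_eq_mul] at key
  refine Eq.trans ?_ (key.trans ?_)
  · refine MeasureTheory.integral_congr_ae (Filter.Eventually.of_forall fun y => ?_)
    simp only [Real.fourierInv_eq, VectorFourier.fourierIntegral]
    simp
  · refine MeasureTheory.integral_congr_ae (Filter.Eventually.of_forall fun ξ => ?_)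
    simp only [Real.fourier_eq', VectorFourier.fourierIntegral, ← integral_conj]
    congr 1
    refine MeasureTheory.integral_congr_ae (Filter.Eventually.of_forall fun y => ?_)
    simp only [smul_eq_mul, map_mul, ← Complex.exp_conj, Circle.smul_def, Real.fourierChar_apply,
      LinearMap.flip_apply, LinearMap.neg_apply, innerₗ_apply_apply, neg_neg, Complex.conj_I,
      Complex.conj_ofReal, real_inner_comm ξ]
    congr 2
    push_cast
    ring

/-! ### Decay of the Gabor matrix -/

lemma norm_sub_sq_le_two_mul {E : Type*} [SeminormedAddCommGroup E] (a b : E) :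
    ‖a - b‖ ^ 2 ≤ 2 * ‖a‖ ^ 2 + 2 * ‖b‖ ^ 2 := by
  have h := norm_sub_le a b
  have h0 := norm_nonneg (a - b)
  nlinarith [sq_nonneg (‖a‖ - ‖b‖), norm_nonneg a, norm_nonneg b]

lemma exp_mul_exp_le {E : Type*} [SeminormedAddCommGroup E] {ε : ℝ} (hε : 0 ≤ ε) (ξ θ η : E) :
    Real.exp (-ε * ‖ξ - θ‖ ^ 2) * Real.exp (-ε * ‖ξ - η‖ ^ 2) ≤
      Real.exp (-(ε / 4) * ‖θ - η‖ ^ 2) * Real.exp (-(ε / 2) * ‖ξ - θ‖ ^ 2) := by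
  rw [← Real.exp_add, ← Real.exp_add, Real.exp_le_exp]
  have h := norm_sub_sq_le_two_mul (ξ - η) (ξ - θ)
  rw [show ξ - η - (ξ - θ) = θ - η by abel] at h
  nlinarith [mul_le_mul_of_nonneg_left h hε, mul_nonneg hε (sq_nonneg ‖ξ - η‖)]

section Decay

variable {d : ℕ} {g : 𝓢(Rd d, ℂ)} {s : (Fin d → ℂ) → ℂ}

/-- The integrand of a Gabor matrix entry, up to a constant phase, at a point with one complex
coordinate. -/
noncomputable def gaborIntegrand {d : ℕ} (s : (Fin d → ℂ) → ℂ) (g : Rd d → ℂ) (j : Fin d)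
    (v θ η ξ : Rd d) (z : ℂ) : ℂ :=
  s (fun i => (ξ i : ℂ) + (Pi.single j z : Fin d → ℂ) i) *
    Complex.exp (2 * Real.pi * Complex.I * (((inner ℝ v ξ : ℝ) : ℂ) + z * v j)) *
    (fourierExt j g (ξ - θ) z *
      (starRingEnd ℂ) (fourierExt j g (ξ - η) ((starRingEnd ℂ) z)))

lemma gaborIntegrand_ofReal {d : ℕ} (s : (Fin d → ℂ) → ℂ) (g : Rd d → ℂ) (j : Fin d)
    (v θ η ξ : Rd d) (r : ℝ) :
    gaborIntegrand s g j v θ η ξ r =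
      gaborIntegrand s g j v θ η (ξ + r • EuclideanSpace.single j (1 : ℝ)) 0 := by
  unfold gaborIntegrand
  have h : ∀ θ : Rd d, fourierExt j g (ξ - θ) r =
      fourierExt j g (ξ + r • EuclideanSpace.single j (1 : ℝ) - θ) 0 := by
    intro θ
    rw [← zero_add (r : ℂ), fourierExt_add_ofReal]
    congr 1
    abel
  rw [Complex.conj_ofReal, h, h, map_zero, inner_add_right, inner_single_right]
  congr 2
  · congr 1
    funext i
    by_cases hi : i = j
    · subst hi; simp
    · simp [hi]
  · push_cast
    ring_nf

lemma norm_exp_gaborIntegrand {d : ℕ} (v ξ : Rd d) (j : Fin d) (z : ℂ) :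
    ‖Complex.exp (2 * Real.pi * Complex.I * (((inner ℝ v ξ : ℝ) : ℂ) + z * v j))‖ =
      Real.exp (-(2 * Real.pi * z.im * v j)) := by
  rw [Complex.norm_exp]
  congr 1
  simp [Complex.mul_re, Complex.mul_im]
  ring

lemma norm_im_single {d : ℕ} (ξ : Rd d) (j : Fin d) (z : ℂ) :
    ‖(WithLp.toLp 2 (fun i => ((ξ i : ℂ) + (Pi.single j z : Fin d → ℂ) i).im) : Rd d)‖ =
      |z.im| := by
  have : (WithLp.toLp 2 (fun i => ((ξ i : ℂ) + (Pi.single j z : Fin d → ℂ) i).im) : Rd d) =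
      EuclideanSpace.single j z.im := by
    ext i
    by_cases hi : i = j
    · subst hi; simp
    · simp [hi]
  rw [this]
  simp

variable {Cs Ms C c ε : ℝ}

lemma norm_gaborIntegrand_le (hMs : 0 ≤ Ms) (hC : 0 ≤ C)
    (hs : ∀ ζ : Fin d → ℂ, ‖s ζ‖ ≤
      Ms * Real.exp (Cs * ‖(WithLp.toLp 2 (fun j => (ζ j).im) : Rd d)‖))
    (hg : ∀ (j : Fin d) (ξ : Rd d) (z : ℂ), ‖fourierExt j g ξ z‖ ≤ C * Real.exp (c * z.im ^ 2) *
      Real.exp (-ε * ‖ξ + z.re • EuclideanSpace.single j (1 : ℝ)‖ ^ 2))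
    (j : Fin d) (v θ η ξ : Rd d) (z : ℂ) :
    ‖gaborIntegrand s g j v θ η ξ z‖ ≤
      Ms * Real.exp (Cs * |z.im|) * Real.exp (-(2 * Real.pi * z.im * v j)) *
        (C ^ 2 * Real.exp (2 * c * z.im ^ 2) *
          (Real.exp (-ε * ‖ξ - θ + z.re • EuclideanSpace.single j (1 : ℝ)‖ ^ 2) *
            Real.exp (-ε * ‖ξ - η + z.re • EuclideanSpace.single j (1 : ℝ)‖ ^ 2))) := by
  unfold gaborIntegrand
  rw [norm_mul, norm_mul, norm_mul, norm_exp_gaborIntegrand, RCLike.norm_conj]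
  have h1 := hs fun i => (ξ i : ℂ) + (Pi.single j z : Fin d → ℂ) i
  rw [norm_im_single] at h1
  have h2 := hg j (ξ - θ) z
  have h3 := hg j (ξ - η) ((starRingEnd ℂ) z)
  rw [Complex.conj_im, Complex.conj_re, neg_sq] at h3
  have h4 := mul_le_mul h2 h3 (norm_nonneg _) (by positivity)
  refine (mul_le_mul (mul_le_mul_of_nonneg_right h1 (Real.exp_pos _).le) h4 (by positivity)
    (by positivity)).trans (le_of_eq ?_)
  rw [show 2 * c * z.im ^ 2 = c * z.im ^ 2 + c * z.im ^ 2 by ring, Real.exp_add]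
  ring

lemma norm_integral_gaborIntegrand_le (hMs : 0 ≤ Ms) (hCs : 0 ≤ Cs) (hC : 0 ≤ C) (hc : 0 ≤ c)
    (hε : 0 < ε) (hsc : Continuous s)
    (hsd : ∀ f : ℂ → Fin d → ℂ, (∀ i, Differentiable ℂ fun z => f z i) →
      Differentiable ℂ fun z => s (f z))
    (hs : ∀ ζ : Fin d → ℂ, ‖s ζ‖ ≤
      Ms * Real.exp (Cs * ‖(WithLp.toLp 2 (fun j => (ζ j).im) : Rd d)‖))
    (hgd : ∀ (j : Fin d) (ξ : Rd d), Differentiable ℂ (fourierExt j g ξ))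
    (hg : ∀ (j : Fin d) (ξ : Rd d) (z : ℂ), ‖fourierExt j g ξ z‖ ≤ C * Real.exp (c * z.im ^ 2) *
      Real.exp (-ε * ‖ξ + z.re • EuclideanSpace.single j (1 : ℝ)‖ ^ 2))
    (j : Fin d) (v θ η : Rd d) {κ : ℝ} (hκ : 0 ≤ κ) :
    ‖∫ ξ, gaborIntegrand s g j v θ η ξ 0‖ ≤
      Ms * C ^ 2 * (∫ x : Rd d, Real.exp (-(ε / 2) * ‖x‖ ^ 2)) *
        Real.exp (-(ε / 4) * ‖θ - η‖ ^ 2) *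
        Real.exp (Cs * κ * |v j| - (2 * Real.pi * κ - 2 * c * κ ^ 2) * v j ^ 2) := by
  have hbound := norm_gaborIntegrand_le (c := c) (ε := ε) hMs hC hs hg
  have hgauss : MeasureTheory.Integrable fun x : Rd d => Real.exp (-(ε / 2) * ‖x‖ ^ 2) :=
    integrable_exp_neg_mul_norm_sq (by positivity)
  have hshift := integral_eq_of_translation_invariant (μ := MeasureTheory.volume)
    (F := gaborIntegrand s g j v θ η) (fun z => ?_) (fun ξ => ?_) (fun R => ?_)
    (fun r _ => ?_) ((κ * v j : ℝ) * Complex.I)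
  · rw [← hshift]
    have him : (((κ * v j : ℝ) : ℂ) * Complex.I).im = κ * v j := by simp
    have hre : (((κ * v j : ℝ) : ℂ) * Complex.I).re = 0 := by simp
    refine (MeasureTheory.norm_integral_le_of_norm_le
      ((hgauss.comp_sub_right θ).const_mul (Ms * Real.exp (Cs * |κ * v j|) *
        Real.exp (-(2 * Real.pi * (κ * v j) * v j)) * (C ^ 2 * Real.exp (2 * c * (κ * v j) ^ 2) *
          Real.exp (-(ε / 4) * ‖θ - η‖ ^ 2))))
      (Filter.Eventually.of_forall fun ξ => (hbound j v θ η ξ _).trans ?_)).trans (le_of_eq ?_)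
    · rw [him, hre, zero_smul, add_zero, add_zero]
      have := exp_mul_exp_le hε.le ξ θ η
      calc _ ≤ Ms * Real.exp (Cs * |κ * v j|) * Real.exp (-(2 * Real.pi * (κ * v j) * v j)) *
            (C ^ 2 * Real.exp (2 * c * (κ * v j) ^ 2) * (Real.exp (-(ε / 4) * ‖θ - η‖ ^ 2) *
              Real.exp (-(ε / 2) * ‖ξ - θ‖ ^ 2))) := by gcongr
        _ = _ := by ring
    · rw [MeasureTheory.integral_const_mul,
        MeasureTheory.integral_sub_right_eq_self (fun x : Rd d => Real.exp (-(ε / 2) * ‖x‖ ^ 2)) θ]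
      have : Real.exp (Cs * κ * |v j| - (2 * Real.pi * κ - 2 * c * κ ^ 2) * v j ^ 2) =
          Real.exp (Cs * |κ * v j|) * Real.exp (-(2 * Real.pi * (κ * v j) * v j)) *
            Real.exp (2 * c * (κ * v j) ^ 2) := by
        rw [← Real.exp_add, ← Real.exp_add, abs_mul, abs_of_nonneg hκ]
        ring_nf
      rw [this]
      ring
  · unfold gaborIntegrand
    have h1 := (stronglyMeasurable_fourierExt j g.continuous z).comp_measurable
      (measurable_id.sub_const θ)
    have h2 := (stronglyMeasurable_fourierExt j g.continuous ((starRingEnd ℂ) z)).comp_measurable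
      (measurable_id.sub_const η)
    have h3 : Continuous fun ξ : Rd d =>
        s (fun i => (ξ i : ℂ) + (Pi.single j z : Fin d → ℂ) i) *
          Complex.exp (2 * Real.pi * Complex.I * (((inner ℝ v ξ : ℝ) : ℂ) + z * v j)) := by
      refine Continuous.mul (hsc.comp ?_) (by fun_prop)
      fun_prop
    exact (h3.stronglyMeasurable.mul
      (h1.mul (Complex.continuous_conj.comp_stronglyMeasurable h2))).aestronglyMeasurable
  · unfold gaborIntegrand
    refine Differentiable.mul (Differentiable.mul (hsd _ fun i => ?_) (by fun_prop))
      (Differentiable.mul (hgd j _) fun z => ?_)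
    · by_cases hi : i = j
      · subst hi; simpa using differentiable_id.const_add _
      · simp [hi]
    · have := (hgd j (ξ - η) ((starRingEnd ℂ) z)).conj_conj
      rwa [Complex.conj_conj] at this
  · refine ⟨_, (hgauss.comp_sub_right θ).const_mul (Ms * Real.exp (Cs * R) *
      Real.exp (2 * Real.pi * R * |v j|) * (C ^ 2 * Real.exp (2 * c * R ^ 2) *
        Real.exp (ε * R ^ 2))), fun ξ z hz => (hbound j v θ η ξ z).trans ?_⟩
    have hi : |z.im| ≤ R := (Complex.abs_im_le_norm z).trans hz
    have hr : |z.re| ≤ R := (Complex.abs_re_le_norm z).trans hz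
    have hR : 0 ≤ R := (abs_nonneg _).trans hi
    have h1 : -(2 * Real.pi * z.im * v j) ≤ 2 * Real.pi * R * |v j| := by
      have : -(z.im * v j) ≤ R * |v j| := by
        refine (neg_le_abs _).trans ?_
        rw [abs_mul]
        gcongr
      nlinarith [Real.pi_pos]
    have h2 : z.im ^ 2 ≤ R ^ 2 := sq_le_sq' (by linarith [neg_abs_le z.im])
      ((le_abs_self _).trans hi)
    have h2' : z.re ^ 2 ≤ R ^ 2 := sq_le_sq' (by linarith [neg_abs_le z.re])
      ((le_abs_self _).trans hr)
    have h3 : Real.exp (-ε * ‖ξ - θ + z.re • EuclideanSpace.single j (1 : ℝ)‖ ^ 2) ≤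
        Real.exp (ε * R ^ 2) * Real.exp (-(ε / 2) * ‖ξ - θ‖ ^ 2) := by
      rw [← Real.exp_add, Real.exp_le_exp]
      have h := norm_sub_sq_le_two_mul (ξ - θ + z.re • EuclideanSpace.single j (1 : ℝ))
        (z.re • EuclideanSpace.single j (1 : ℝ))
      rw [add_sub_cancel_right] at h
      have hn : ‖z.re • (EuclideanSpace.single j (1 : ℝ) : Rd d)‖ ^ 2 = z.re ^ 2 := by
        rw [norm_smul, PiLp.norm_single, norm_one, mul_one, Real.norm_eq_abs, sq_abs]
      rw [hn] at h
      nlinarith [mul_le_mul_of_nonneg_left h hε.le, mul_le_mul_of_nonneg_left h2' hε.le]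
    have h4 : Real.exp (-ε * ‖ξ - η + z.re • EuclideanSpace.single j (1 : ℝ)‖ ^ 2) ≤ 1 := by
      rw [Real.exp_le_one_iff, neg_mul, neg_nonpos]
      positivity
    calc _ ≤ Ms * Real.exp (Cs * R) * Real.exp (2 * Real.pi * R * |v j|) *
          (C ^ 2 * Real.exp (2 * c * R ^ 2) *
            (Real.exp (ε * R ^ 2) * Real.exp (-(ε / 2) * ‖ξ - θ‖ ^ 2) * 1)) := by gcongr
      _ = _ := by ring
  · simp only [gaborIntegrand_ofReal s g j v θ η _ r]
    exact MeasureTheory.integral_add_right_eq_self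
      (fun ξ => gaborIntegrand s g j v θ η ξ 0) (r • EuclideanSpace.single j (1 : ℝ))

end Decay

lemma mul_abs_sub_mul_sq_le {C κ x : ℝ} (hκ : 0 ≤ κ) :
    C * κ * |x| - Real.pi * κ * x ^ 2 ≤
      C ^ 2 * κ / (2 * Real.pi) + -(Real.pi * κ / 2) * x ^ 2 := by
  have hpi := Real.pi_pos
  have h : C * |x| ≤ C ^ 2 / (2 * Real.pi) + Real.pi / 2 * x ^ 2 := by
    rw [← sq_abs x, div_add' _ _ _ (by positivity), le_div_iff₀ (by positivity)]
    nlinarith [sq_nonneg (C - Real.pi * |x|)]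
  have h2 := mul_le_mul_of_nonneg_left h hκ
  have e : κ * (C ^ 2 / (2 * Real.pi) + Real.pi / 2 * x ^ 2) =
      C ^ 2 * κ / (2 * Real.pi) + Real.pi * κ / 2 * x ^ 2 := by ring
  rw [e] at h2
  linarith

section Gabor

variable {d : ℕ} {g : 𝓢(Rd d, ℂ)} {s : (Fin d → ℂ) → ℂ} {Cs Ms C₁ ε₁ : ℝ}

lemma integrable_mul_fourier_tfShift (hMs : 0 ≤ Ms) (hε₁ : 0 < ε₁) {σ : Rd d → ℂ}
    (hσ : Continuous σ) (hσM : ∀ ξ, ‖σ ξ‖ ≤ Ms)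
    (hF : ∀ ξ, ‖𝓕 (g : Rd d → ℂ) ξ‖ ≤ C₁ * Real.exp (-ε₁ * ‖ξ‖ ^ 2)) (z : TFPlane d) :
    MeasureTheory.Integrable fun ξ => σ ξ * 𝓕 (tfShift z g) ξ := by
  have hcont : Continuous (𝓕 (tfShift z g)) :=
    VectorFourier.fourierIntegral_continuous Real.continuous_fourierChar
      (by exact continuous_inner) (integrable_tfShift z g)
  refine ((((integrable_exp_neg_mul_norm_sq hε₁).comp_sub_right z.snd).const_mul C₁).const_mul
    Ms).mono' (hσ.mul hcont).aestronglyMeasurable (Filter.Eventually.of_forall fun ξ => ?_)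
  rw [norm_mul, norm_fourier_tfShift]
  exact mul_le_mul (hσM ξ) (hF _) (norm_nonneg _) hMs

lemma integrable_fourierMultiplier_mul_conj {σ f : Rd d → ℂ}
    (hσ : MeasureTheory.Integrable fun ξ => σ ξ * 𝓕 f ξ) (w : TFPlane d) :
    MeasureTheory.Integrable fun y => fourierMultiplier σ f y *
      (starRingEnd ℂ) (tfShift w g y) := by
  have hcont : Continuous (fourierMultiplier σ f) := by
    have h := VectorFourier.fourierIntegral_continuous (L := -innerₗ (Rd d))
      Real.continuous_fourierChar (by
        simp only [LinearMap.neg_apply, innerₗ_apply_apply]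
        fun_prop) hσ
    refine h.congr fun y => ?_
    simp only [fourierMultiplier, Real.fourierInv_eq, VectorFourier.fourierIntegral]
    simp
  have hconj : MeasureTheory.Integrable fun y => (starRingEnd ℂ) (tfShift w g y) :=
    (LinearIsometryEquiv.integrable_comp_iff (Complex.conjLIE)).2 (integrable_tfShift w g)
  refine hconj.bdd_mul (c := ∫ ξ, ‖σ ξ * 𝓕 f ξ‖) hcont.aestronglyMeasurable
    (Filter.Eventually.of_forall fun y => ?_)
  rw [fourierMultiplier, Real.fourierInv_eq]
  refine (MeasureTheory.norm_integral_le_integral_norm _).trans (le_of_eq ?_)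
  simp only [Circle.norm_smul]

lemma norm_gaborMatrix_le (hMs : 0 ≤ Ms) (hε₁ : 0 < ε₁) {σ : Rd d → ℂ}
    (hσ : Continuous σ) (hσM : ∀ ξ, ‖σ ξ‖ ≤ Ms)
    (hF : ∀ ξ, ‖𝓕 (g : Rd d → ℂ) ξ‖ ≤ C₁ * Real.exp (-ε₁ * ‖ξ‖ ^ 2)) (z w : TFPlane d) :
    ‖gaborMatrix (fourierMultiplier σ) g z w‖ ≤
      Ms * C₁ ^ 2 * (∫ x : Rd d, Real.exp (-(ε₁ / 2) * ‖x‖ ^ 2)) *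
        Real.exp (-(ε₁ / 4) * ‖z.snd - w.snd‖ ^ 2) := by
  have hgauss : MeasureTheory.Integrable fun x : Rd d => Real.exp (-(ε₁ / 2) * ‖x‖ ^ 2) :=
    integrable_exp_neg_mul_norm_sq (by positivity)
  unfold gaborMatrix fourierMultiplier
  rw [integral_fourierInv_mul_conj (integrable_mul_fourier_tfShift hMs hε₁ hσ hσM hF z)
    (integrable_tfShift w g)]
  refine (MeasureTheory.norm_integral_le_of_norm_le
    ((hgauss.comp_sub_right z.snd).const_mul (Ms * C₁ ^ 2 *
      Real.exp (-(ε₁ / 4) * ‖z.snd - w.snd‖ ^ 2)))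
    (Filter.Eventually.of_forall fun ξ => ?_)).trans (le_of_eq ?_)
  · rw [norm_mul, norm_mul, RCLike.norm_conj, norm_fourier_tfShift, norm_fourier_tfShift,
      mul_assoc ‖σ ξ‖]
    have h1 := mul_le_mul (hF (ξ - z.snd)) (hF (ξ - w.snd)) (norm_nonneg _)
      ((norm_nonneg _).trans (hF _))
    calc _ ≤ Ms * (C₁ * Real.exp (-ε₁ * ‖ξ - z.snd‖ ^ 2) *
          (C₁ * Real.exp (-ε₁ * ‖ξ - w.snd‖ ^ 2))) :=
          mul_le_mul (hσM ξ) h1 (by positivity) hMs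
      _ = Ms * C₁ ^ 2 * (Real.exp (-ε₁ * ‖ξ - z.snd‖ ^ 2) *
          Real.exp (-ε₁ * ‖ξ - w.snd‖ ^ 2)) := by ring
      _ ≤ Ms * C₁ ^ 2 * (Real.exp (-(ε₁ / 4) * ‖z.snd - w.snd‖ ^ 2) *
          Real.exp (-(ε₁ / 2) * ‖ξ - z.snd‖ ^ 2)) :=
          mul_le_mul_of_nonneg_left (exp_mul_exp_le hε₁.le ξ z.snd w.snd) (by positivity)
      _ = _ := by ring
  · rw [MeasureTheory.integral_const_mul, MeasureTheory.integral_sub_right_eq_self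
      (fun x : Rd d => Real.exp (-(ε₁ / 2) * ‖x‖ ^ 2)) z.snd]
    ring

lemma norm_gaborMatrix_eq {σ : Rd d → ℂ} (hσs : ∀ ξ : Rd d, σ ξ = s fun i => (ξ i : ℂ))
    (z w : TFPlane d) (hint : MeasureTheory.Integrable fun ξ => σ ξ * 𝓕 (tfShift z g) ξ)
    (j : Fin d) :
    ‖gaborMatrix (fourierMultiplier σ) g z w‖ =
      ‖∫ ξ, gaborIntegrand s g j (w.fst - z.fst) z.snd w.snd ξ 0‖ := by
  unfold gaborMatrix fourierMultiplier
  rw [integral_fourierInv_mul_conj hint (integrable_tfShift w g)]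
  have key : ∀ ξ, σ ξ * 𝓕 (tfShift z g) ξ * (starRingEnd ℂ) (𝓕 (tfShift w g) ξ) =
      Complex.exp (2 * Real.pi * Complex.I *
        ((inner ℝ z.fst z.snd - inner ℝ w.fst w.snd : ℝ) : ℂ)) *
        gaborIntegrand s g j (w.fst - z.fst) z.snd w.snd ξ 0 := by
    intro ξ
    unfold gaborIntegrand
    rw [fourier_tfShift, fourier_tfShift, map_zero, fourierExt_zero, fourierExt_zero, hσs,
      map_mul, ← Complex.exp_conj]
    simp only [map_mul, map_neg, Complex.conj_ofReal, Complex.conj_I, map_ofNat, Pi.single_zero,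
      Pi.zero_apply, add_zero, zero_mul]
    have e : Complex.exp (2 * Real.pi * Complex.I *
          ((inner ℝ z.fst z.snd - inner ℝ w.fst w.snd : ℝ) : ℂ)) *
        Complex.exp (2 * Real.pi * Complex.I * ((inner ℝ (w.fst - z.fst) ξ : ℝ) : ℂ)) =
        Complex.exp (-2 * Real.pi * Complex.I * ((inner ℝ z.fst (ξ - z.snd) : ℝ) : ℂ)) *
        Complex.exp (-2 * Real.pi * -Complex.I * ((inner ℝ w.fst (ξ - w.snd) : ℝ) : ℂ)) := by
      rw [← Complex.exp_add, ← Complex.exp_add]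
      congr 1
      simp only [inner_sub_left, inner_sub_right]
      push_cast
      ring
    linear_combination -(s fun i => (ξ i : ℂ)) * 𝓕 (g : Rd d → ℂ) (ξ - z.snd) *
      (starRingEnd ℂ) (𝓕 (g : Rd d → ℂ) (ξ - w.snd)) * e
  simp only [key]
  rw [MeasureTheory.integral_const_mul, norm_mul, norm_exp_two_pi_I_mul, one_mul]

end Gabor

theorem gaborMatrix_decay {d n : ℕ} {a : ℕ → MvPolynomial (Fin d) ℂ}
    (hP : RefinedHadamardPetrowsky (n + 1) a 1) {σ : ℝ → Rd d → ℂ}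
    (hσ : IsFundamentalSymbol (n + 1) a σ) {g : 𝓢(Rd d, ℂ)}
    (hg : IsGelfandShilov (1 / 2) (1 / 2) g) (T : ℝ) :
    ∃ C ε : ℝ, 0 < C ∧ 0 < ε ∧ ∀ t ∈ Set.Icc 0 T, ∀ z w : TFPlane d,
      MeasureTheory.Integrable (fun ξ => σ t ξ * 𝓕 (tfShift z g) ξ) ∧
      MeasureTheory.Integrable (fun y => fourierMultiplier (σ t) (tfShift z g) y *
        (starRingEnd ℂ) (tfShift w g y)) ∧
      ‖gaborMatrix (fourierMultiplier (σ t)) g z w‖ ≤ C * Real.exp (-ε * ‖w - z‖ ^ 2) := by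
  obtain ⟨Cs, Ms, hCs, hMs, hs⟩ := hP.norm_complexSymbol_le T
  obtain ⟨C₁, ε₁, hC₁, hε₁, hF⟩ := hg.norm_fourier_le
  obtain ⟨C, c, ε, hC, hc, hε, hE⟩ := hg.norm_fourierExt_le
  obtain ⟨K, ε₀, hK, hε₀, hg0⟩ := hg.norm_le
  have hpi := Real.pi_pos
  set κ := Real.pi / (2 * c) with hκ
  have hκ0 : 0 < κ := by positivity
  have hκc : 2 * Real.pi * κ - 2 * c * κ ^ 2 = Real.pi * κ := by
    rw [hκ]; field_simp; ring
  set I₁ := ∫ x : Rd d, Real.exp (-(ε₁ / 2) * ‖x‖ ^ 2) with hI₁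
  set I₂ := ∫ x : Rd d, Real.exp (-(ε / 2) * ‖x‖ ^ 2) with hI₂
  have hI₁0 : 0 ≤ I₁ := MeasureTheory.integral_nonneg fun x => (Real.exp_pos _).le
  have hI₂0 : 0 ≤ I₂ := MeasureTheory.integral_nonneg fun x => (Real.exp_pos _).le
  set M := Ms * C₁ ^ 2 * I₁ + Ms * C ^ 2 * I₂ * Real.exp (Cs ^ 2 * κ / (2 * Real.pi)) + 1 with hM
  set ε₂ := min (ε₁ / 4) (ε / 4) with hε₂
  set ε₃ := Real.pi * κ / 2 / (d + 1) with hε₃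
  have hM0 : 0 < M := by positivity
  have hε₂0 : 0 < ε₂ := by positivity
  have hε₃0 : 0 < ε₃ := by positivity
  refine ⟨M, min ε₂ ε₃, hM0, lt_min hε₂0 hε₃0, fun t ht z w => ?_⟩
  have hσs : ∀ ξ : Rd d, σ t ξ = complexSymbol n a t fun i => (ξ i : ℂ) :=
    fun ξ => hσ.eq_complexSymbol ht.1 ξ
  have hσc : Continuous (σ t) := by
    rw [show σ t = fun ξ : Rd d => complexSymbol n a t fun i => (ξ i : ℂ) from funext hσs]
    exact (continuous_complexSymbol n a t).comp (by fun_prop)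
  have hσM : ∀ ξ, ‖σ t ξ‖ ≤ Ms := fun ξ => by
    rw [hσs]
    refine (hs t ht _).trans (le_of_eq ?_)
    have : (WithLp.toLp 2 (fun j => ((ξ j : ℂ)).im) : Rd d) = 0 := by ext; simp
    rw [this]
    simp
  have hint := integrable_mul_fourier_tfShift hMs.le hε₁ hσc hσM hF z
  refine ⟨hint, integrable_fourierMultiplier_mul_conj hint w, ?_⟩
  have h0 := norm_gaborMatrix_le hMs.le hε₁ hσc hσM hF z w
  set D := ‖gaborMatrix (fourierMultiplier (σ t)) g z w‖ with hD
  set N := ‖z.snd - w.snd‖ ^ 2 with hN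
  have hN0 : 0 ≤ N := by positivity
  set v := w.fst - z.fst with hv
  have hsum : 0 ≤ Ms * C ^ 2 * I₂ * Real.exp (Cs ^ 2 * κ / (2 * Real.pi)) := by positivity
  have hsum₁ : 0 ≤ Ms * C₁ ^ 2 * I₁ := by positivity
  have h1 : D ≤ M * Real.exp (-ε₂ * N) := by
    refine h0.trans (mul_le_mul (by rw [hM]; linarith) (Real.exp_le_exp.2 ?_)
      (Real.exp_pos _).le hM0.le)
    exact mul_le_mul_of_nonneg_right (neg_le_neg (min_le_left _ _)) hN0
  have h2 : ∀ j, D ≤ M * Real.exp (-ε₂ * N) * Real.exp (-(Real.pi * κ / 2) * v j ^ 2) := by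
    intro j
    have hb := norm_integral_gaborIntegrand_le hMs.le hCs.le hC.le hc.le hε
      (continuous_complexSymbol n a t)
      (fun f hf => differentiable_complexSymbol_comp n a t hf) (hs t ht)
      (fun j ξ => differentiable_fourierExt j hε₀ hK.le hg0 ξ) hE j v z.snd w.snd hκ0.le
    rw [← norm_gaborMatrix_eq hσs z w hint j, hκc] at hb
    have he : Real.exp (Cs * κ * |v j| - Real.pi * κ * v j ^ 2) ≤
        Real.exp (Cs ^ 2 * κ / (2 * Real.pi)) * Real.exp (-(Real.pi * κ / 2) * v j ^ 2) := by
      rw [← Real.exp_add, Real.exp_le_exp]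
      exact mul_abs_sub_mul_sq_le hκ0.le
    have he' : Real.exp (-(ε / 4) * N) ≤ Real.exp (-ε₂ * N) :=
      Real.exp_le_exp.2 (mul_le_mul_of_nonneg_right (neg_le_neg (min_le_right _ _)) hN0)
    calc D ≤ Ms * C ^ 2 * I₂ * Real.exp (-(ε / 4) * N) *
          Real.exp (Cs * κ * |v j| - Real.pi * κ * v j ^ 2) := hb
      _ ≤ Ms * C ^ 2 * I₂ * Real.exp (-ε₂ * N) * (Real.exp (Cs ^ 2 * κ / (2 * Real.pi)) *
          Real.exp (-(Real.pi * κ / 2) * v j ^ 2)) := by gcongr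
      _ = Ms * C ^ 2 * I₂ * Real.exp (Cs ^ 2 * κ / (2 * Real.pi)) * Real.exp (-ε₂ * N) *
          Real.exp (-(Real.pi * κ / 2) * v j ^ 2) := by ring
      _ ≤ _ := by
          gcongr
          rw [hM]; linarith
  have h3 := le_mul_exp_neg_norm_sq (by positivity) (by positivity) v h1 h2
  have hnorm : ‖w - z‖ ^ 2 = ‖v‖ ^ 2 + N := by
    rw [WithLp.prod_norm_sq_eq_of_L2, hN, norm_sub_rev z.snd]
    rfl
  rw [mul_assoc, ← Real.exp_add] at h3
  refine h3.trans (mul_le_mul_of_nonneg_left (Real.exp_le_exp.2 ?_) hM0.le)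
  rw [hnorm]
  have e1 : min ε₂ ε₃ * N ≤ ε₂ * N := mul_le_mul_of_nonneg_right (min_le_left _ _) hN0
  have e2 : min ε₂ ε₃ * ‖v‖ ^ 2 ≤ ε₃ * ‖v‖ ^ 2 :=
    mul_le_mul_of_nonneg_right (min_le_right _ _) (sq_nonneg _)
  linarith

theorem mainTheorem2 (d m : ℕ) (hm : 1 ≤ m) (a : ℕ → MvPolynomial (Fin d) ℂ)
    (hP : IsHyperbolic m a) :
    RefinedHadamardPetrowsky m a 1 ∧
    (∃! σ : ℝ → Rd d → ℂ, IsFundamentalSymbol m a σ) ∧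
    ∀ σ : ℝ → Rd d → ℂ, IsFundamentalSymbol m a σ →
      ∀ g : 𝓢(Rd d, ℂ), IsGelfandShilov (1 / 2) (1 / 2) g →
        ∀ T : ℝ, ∃ C ε : ℝ, 0 < C ∧ 0 < ε ∧
          ∀ t ∈ Set.Icc 0 T, ∀ z w : TFPlane d,
            MeasureTheory.Integrable (fun ξ => σ t ξ * 𝓕 (tfShift z g) ξ) ∧
            MeasureTheory.Integrable (fun y => fourierMultiplier (σ t) (tfShift z g) y *
              (starRingEnd ℂ) (tfShift w g y)) ∧
            ‖gaborMatrix (fourierMultiplier (σ t)) g z w‖ ≤ C * Real.exp (-ε * ‖w - z‖ ^ 2) := by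
  obtain ⟨n, rfl⟩ : ∃ n, m = n + 1 := ⟨m - 1, by omega⟩
  have hR := refinedHadamardPetrowsky_one_of_isHyperbolic hP
  refine ⟨hR, ⟨_, isFundamentalSymbol_forwardSolution n a, fun τ hτ =>
    hτ.unique (isFundamentalSymbol_forwardSolution n a)⟩, fun σ hσ g hg T =>
    gaborMatrix_decay hR hσ hg T⟩
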